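/- Let $\mathbb K$ be a field of characteristic $0$ and let $\mathfrak g=\bigoplus_{p\in\mathbb Z}\mathfrak g_p$ be a finite-dimensional $\mathbb Z$-graded Lie algebra over $\mathbb K$. Put $\mathfrak m=\bigoplus_{p<0}\mathfrak g_p$ and $\mathfrak g_+=\bigoplus_{p\ge 0}\mathfrak g_p$. Let $\mathfrak r$ be the solvable radical and $\mathfrak n$ the maximal nilpotent ideal of $\mathfrak g$, and let $\mathfrak r_p=\mathfrak r\cap\mathfrak g_p$. Let $\rho:\mathfrak g_0\to\mathfrak{gl}(\mathfrak m)$ be the restriction of the adjoint representation. Assume that $\mathfrak g$ is * quasi-effective: $\{X\in\mathfrak g_+\mid[X,\mathfrak m]\subseteq\mathfrak m\}\subseteq\mathfrak g_0$ and $\{X\in\mathfrak g_0\mid[X,\mathfrak m]=0\}=0$; * of reductive type: $\mathfrak n\cap\mathfrak g_0=0$. The depth of a graded subspace is the largest integer $p$ such that its component of degree $-p$ is nonzero (and $0$ for the zero subspace). A graded Levi factor is a graded semisimple Lie subalgebra $\mathfrak s$ with $\mathfrak g=\mathfrak s\oplus\mathfrak r$ as vector spaces. Call $\mathfrak g$ decomposable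 if $\operatorname{ad}(\mathfrak g)$ equals the Lie subalgebra of $\mathfrak{gl}(\mathfrak g)$ generated by the semisimple and nilpotent Jordan–Chevalley components of the elements of $\operatorname{ad}(\mathfrak g)$. Then: 1. $\mathfrak g$ has a graded Levi factor. All graded Levi factors $\mathfrak s$ have the same depth $\mu_s$, and each satisfies $\mathfrak s=\bigoplus_{p=-\mu_s}^{\mu_s}(\mathfrak s\cap\mathfrak g_p)$. 2. If $\mu_r$ is the depth of $\mathfrak r$, then $\mathfrak r=\bigoplus_{p=-\mu_r}^{0}\mathfrak r_p$; in particular $\mathfrak r_p=0$ for all $p>0$. 3. $\mathfrak g$ is decomposable if and only if $\rho(A)$ is a semisimple endomorphism of $\mathfrak m$ for every $A\in\mathfrak r_0$. 4. If $\mathfrak g$ is decomposable, then a graded Levi factor $\mathfrak s$ can be chosen such that $[\mathfrak r_0,\mathfrak s]=0$. -/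

import Mathlib

attribute [local instance 100] LieRing.ofAssociativeRing

namespace GradedLie

section Decomposable

variable {K : Type*} [Field K] {V : Type*} [AddCommGroup V] [Module K V]

/-- `A = S + N` is the Jordan–Chevalley decomposition of `A`: `S` is semisimple, `N` is nilpotent
and they commute. -/
structure IsJordanChevalley (A S N : Module.End K V) : Prop where
  eq_add : A = S + N
  commute : Commute S N
  semisimple : S.IsSemisimple
  nilpotent : IsNilpotent N

/-- The decomposable envelope of a Lie subalgebra `h` of `gl(V)`: the Lie subalgebra generated by
the semisimple and nilpotent components of the elements of `h`. -/
def decomposableEnvelope (h : LieSubalgebra K (Module.End K V)) :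
    LieSubalgebra K (Module.End K V) :=
  LieSubalgebra.lieSpan K (Module.End K V)
    {X | ∃ A ∈ h, ∃ S N : Module.End K V, IsJordanChevalley A S N ∧ (X = S ∨ X = N)}

/-- A Lie subalgebra of `gl(V)` is decomposable in `V` when it equals its decomposable envelope. -/
def IsDecomposableIn (h : LieSubalgebra K (Module.End K V)) : Prop :=
  decomposableEnvelope h = h

/-- A Lie algebra `L` is decomposable when `ad L` is decomposable in `L`. -/
def IsDecomposable (K L : Type*) [Field K] [LieRing L] [LieAlgebra K L] : Prop :=
  IsDecomposableIn (LieAlgebra.ad K L).range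

end Decomposable

section Graded

variable {K L : Type*} [Field K] [LieRing L] [LieAlgebra K L]

variable (K L) in
/-- The maximal nilpotent ideal (nilradical) of `L`: the sum of all ideals of `L` that are
nilpotent as Lie algebras. (Mathlib's `LieAlgebra.maxNilpotentIdeal` is a different ideal: it is
the largest ideal on which the whole of `L` acts nilpotently.) -/
def nilradical : LieIdeal K L :=
  sSup {I : LieIdeal K L | LieRing.IsNilpotent I}

/-- `m`, the sum of the homogeneous subspaces of negative degree. -/
def negPart (ℒ : ℤ → Submodule K L) : Submodule K L :=
  ⨆ p : ℤ, ⨆ _ : p < 0, ℒ p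

/-- `g₊`, the sum of the homogeneous subspaces of nonnegative degree. -/
def nonnegPart (ℒ : ℤ → Submodule K L) : Submodule K L :=
  ⨆ p : ℤ, ⨆ _ : 0 ≤ p, ℒ p

/-- A graded Lie algebra is quasi-effective if every `X ∈ g₊` with `[X, m] ⊆ m` is homogeneous of
degree `0`, and every `X ∈ g₀` with `[X, m] = 0` vanishes. -/
structure IsQuasiEffective (ℒ : ℤ → Submodule K L) : Prop where
  mem_zero : ∀ X ∈ nonnegPart ℒ, (∀ Y ∈ negPart ℒ, ⁅X, Y⁆ ∈ negPart ℒ) → X ∈ ℒ 0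
  eq_zero : ∀ X ∈ ℒ 0, (∀ Y ∈ negPart ℒ, ⁅X, Y⁆ = 0) → X = 0

/-- A graded Lie algebra is of reductive type if its maximal nilpotent ideal has no nonzero
element of degree `0`. -/
def IsOfReductiveType (ℒ : ℤ → Submodule K L) : Prop :=
  (nilradical K L).toSubmodule ⊓ ℒ 0 = ⊥

/-- The depth of a graded subspace `V`: the largest integer `p` for which `V` has a nonzero
homogeneous component of degree `-p` (and `0` if `V = 0`). -/
noncomputable def depth (ℒ : ℤ → Submodule K L) (V : Submodule K L) : ℤ :=
  sSup {p : ℤ | V ⊓ ℒ (-p) ≠ ⊥}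

/-- A graded semisimple Levi factor: a semisimple Lie subalgebra, spanned by its homogeneous
elements, that is a linear complement of the solvable radical. -/
structure IsGradedLeviFactor (ℒ : ℤ → Submodule K L) (s : LieSubalgebra K L) : Prop where
  graded : s.toSubmodule = ⨆ p : ℤ, s.toSubmodule ⊓ ℒ p
  semisimple : LieAlgebra.IsSemisimple K s
  isCompl : IsCompl s.toSubmodule (LieAlgebra.radical K L).toSubmodule

variable (ℒ : ℤ → Submodule K L) [GradedLieAlgebra ℒ]

/-- The structure subalgebra `g₀`. -/
def structureSubalgebra : LieSubalgebra K L :=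
  { ℒ 0 with
    lie_mem' := fun {x y} hx hy => by
      have h := SetLike.GradedBracket.bracket_mem (ℒ := ℒ) (i := 0) (j := 0) hx hy
      simpa using h }

theorem lie_mem_negPart {A : L} (hA : A ∈ ℒ 0) {Y : L} (hY : Y ∈ negPart ℒ) :
    ⁅A, Y⁆ ∈ negPart ℒ := by
  have h : negPart ℒ ≤ (negPart ℒ).comap (LieAlgebra.ad K L A : L →ₗ[K] L) := by
    refine iSup₂_le fun p hp y hy => ?_
    have h1 : ⁅A, y⁆ ∈ ℒ p := by
      simpa using SetLike.GradedBracket.bracket_mem (ℒ := ℒ) (i := 0) (j := p) hA hy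
    exact (le_iSup₂ (f := fun (p : ℤ) (_ : p < 0) => ℒ p) p hp) h1
  exact h hY

/-- The representation `ρ : g₀ → gl(m)` obtained by restricting the adjoint representation. -/
def rho : structureSubalgebra ℒ →ₗ⁅K⁆ Module.End K (negPart ℒ) where
  toFun A := (LieAlgebra.ad K L (A : L)).restrict fun _ hY => lie_mem_negPart ℒ A.2 hY
  map_add' A B := LinearMap.ext fun Y => Subtype.ext (add_lie (A : L) (B : L) (Y : L))
  map_smul' c A := LinearMap.ext fun Y => Subtype.ext (smul_lie c (A : L) (Y : L))
  map_lie' {A B} := LinearMap.ext fun Y => Subtype.ext (lie_lie (A : L) (B : L) (Y : L))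

@[simp]
theorem coe_rho_apply (A : structureSubalgebra ℒ) (Y : negPart ℒ) :
    (rho ℒ A Y : L) = ⁅(A : L), (Y : L)⁆ := rfl

end Graded

end GradedLie

/-! Everything rests on the ideal `adNilIdeal` of those elements of the radical r that are
`ad`-nilpotent. It contains [g, r], it lies in the nilradical, and it contains every homogeneous
element of r of nonzero degree, since such elements are `ad`-nilpotent. Reductive type makes its
degree 0 part vanish. Hence [g₀, r₀] = 0. Moreover, for x in r of positive degree, an induction on
the degree gives [x, m] ⊆ m, so quasi-effectiveness forces x = 0.

The grading is encoded by the Euler derivation, which is semisimple, and a subspace is graded as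
soon as it is stable under it. Levi's theorem is proved relative to a semisimple derivation
(`exists_levi`) by a cohomological argument resting on Casimir elements, followed by averaging over
the derivation. A graded Levi factor meets g_p exactly when g_p is not contained in r. This
condition is symmetric in p and -p because r is the Killing orthogonal of [g, g] and degrees p, q
pair trivially unless p + q = 0.

For decomposability, ρ(A) is semisimple exactly when `ad A` is (`isSemisimple_rho_iff`): the
nilpotent part of `ad A` is a derivation of degree 0, and if it kills m then quasi-effectiveness
makes it zero. If g is decomposable and A ∈ r₀, the nilpotent part of `ad A` is `ad C` with C ∈ g₀;
this C lies in r and is `ad`-nilpotent, so it is 0. Conversely, if r₀ acts semisimply, intersecting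
centralizers gives a Levi factor s commuting with r₀. Every x is then t + u + ν, where t is the sum
of a semisimple part from s and an element of r₀, u is a nilpotent part from s, and ν is in
`adNilIdeal`. An automorphism built from exponentials makes ν commute with t
(`exists_lieEquiv_add`), so both Jordan parts of `ad x` are inner. -/

namespace GradedLie

open Polynomial

/-! ### Jordan–Chevalley decompositions and Fitting-type splittings. -/

section LinearAlgebra

variable {K : Type*} [Field K] {V W : Type*} [AddCommGroup V] [Module K V]
  [AddCommGroup W] [Module K W]

theorem aeval_intertwine {T : Module.End K V} {T' : Module.End K W} {φ : V →ₗ[K] W}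
    (h : ∀ v, φ (T v) = T' (φ v)) (p : K[X]) (v : V) : φ (aeval T p v) = aeval T' p (φ v) := by
  induction p using Polynomial.induction_on' with
  | add p q hp hq => simp only [map_add, LinearMap.add_apply, hp, hq]
  | monomial n a =>
    rw [aeval_monomial, aeval_monomial, Module.End.mul_apply, Module.End.mul_apply,
      Module.algebraMap_end_apply, Module.algebraMap_end_apply, map_smul]
    congr 1
    induction n with
    | zero => rfl
    | succ n ih => rw [pow_succ', pow_succ', Module.End.mul_apply, Module.End.mul_apply, h, ih]

/-- In characteristic zero, an endomorphism `T` with `tr (T * p(T)) = 0` for all `p` is nilpotent. -/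
theorem isNilpotent_of_trace_mul_aeval [CharZero K] [FiniteDimensional K V] (T : Module.End K V)
    (h : ∀ p : K[X], LinearMap.trace K V (T * aeval T p) = 0) : IsNilpotent T := by
  have h0 : minpoly K T ≠ 0 := minpoly.ne_zero_of_finite K T
  obtain ⟨m, g, hg, hmg⟩ : ∃ (m : ℕ) (g : K[X]), ¬ X ∣ g ∧ minpoly K T = X ^ m * g := by
    have hfin : FiniteMultiplicity (X : K[X]) (minpoly K T) :=
      FiniteMultiplicity.of_prime_left prime_X h0
    obtain ⟨g, hg, hg'⟩ := hfin.exists_eq_pow_mul_and_not_dvd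
    exact ⟨_, g, hg', hg⟩
  have hcop : IsCoprime (X ^ (m + 1)) g :=
    IsCoprime.pow_left ((Irreducible.coprime_iff_not_dvd (irreducible_X (R := K))).mpr hg)
  obtain ⟨a, c, hac⟩ := hcop
  have hmin : aeval T (X ^ m * g) = 0 := by rw [← hmg, minpoly.aeval]
  -- `e` is the Fitting projector onto the part where `T` is invertible. It is a polynomial multiple
  -- of `T`, so its trace vanishes, and in characteristic zero an idempotent of trace 0 is 0.
  set e := aeval T (a * X ^ (m + 1)) with he
  have hidem : IsIdempotentElem e := by
    have h1 : aeval T ((a * X ^ (m + 1)) * (a * X ^ (m + 1))) = e := by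
      have : (a * X ^ (m + 1)) * (a * X ^ (m + 1)) =
          (a * X ^ (m + 1)) - (a * X * c) * (X ^ m * g) := by
        have : c * g = 1 - a * X ^ (m + 1) := by rw [← hac]; ring
        calc _ = (a * X ^ (m + 1)) - (a * X ^ (m + 1)) * (1 - a * X ^ (m + 1)) := by ring
          _ = _ := by rw [← this]; ring
      rw [this, map_sub, map_mul (aeval T) (a * X * c), hmin, mul_zero, sub_zero]
    rwa [map_mul] at h1
  have hT : e = T * aeval T (a * X ^ m) := by
    rw [he, show a * X ^ (m + 1) = X * (a * X ^ m) by ring, map_mul, aeval_X]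
  have hz : e = 0 := by
    refine LinearMap.IsIdempotentElem.eq_zero_of_trace_eq_zero hidem ?_
    rw [hT]; exact h _
  refine ⟨m, ?_⟩
  have : aeval T ((X : K[X]) ^ m) = 0 := by
    have h2 : (X : K[X]) ^ m = X ^ m * (a * X ^ (m + 1)) + c * (X ^ m * g) := by
      calc (X : K[X]) ^ m = X ^ m * (a * X ^ (m + 1) + c * g) := by rw [hac, mul_one]
        _ = _ := by ring
    rw [h2, map_add, map_mul, map_mul (aeval T) c, hmin, ← he, hz]; simp
  simpa using this

/-- If `S` is semisimple, `N` is nilpotent and `S N = N S`, then `(S + N) v = 0` gives `S v = 0`. -/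
theorem IsJordanChevalley.semisimple_apply_eq_zero {A S N : Module.End K V}
    (h : IsJordanChevalley A S N) {v : V} (hv : A v = 0) : S v = 0 := by
  have hAS : Commute A S := by rw [h.eq_add]; exact (Commute.refl S).add_left h.commute.symm
  have hmap : ∀ w ∈ LinearMap.ker A, S w ∈ LinearMap.ker A := by
    intro w hw
    have : A (S w) = S (A w) := LinearMap.congr_fun hAS.eq w
    rw [LinearMap.mem_ker] at hw ⊢
    rw [this, hw, map_zero]
  have hmapN : ∀ w ∈ LinearMap.ker A, N w ∈ LinearMap.ker A := by
    intro w hw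
    have h1 : N w = A w - S w := by rw [h.eq_add]; simp
    rw [h1]
    exact Submodule.sub_mem _ (by rw [LinearMap.mem_ker.mp hw]; exact Submodule.zero_mem _)
      (hmap w hw)
  have hss := h.semisimple.restrict hmap
  -- On `ker A` one has `S = -N`, so there `S` is both semisimple and nilpotent.
  have hnil : IsNilpotent (LinearMap.restrict S hmap) := by
    have : LinearMap.restrict S hmap = - LinearMap.restrict N hmapN := by
      ext w
      have hw : S w + N w = 0 := by
        rw [← LinearMap.add_apply, ← h.eq_add]; exact LinearMap.mem_ker.mp w.2
      simpa using! eq_neg_of_add_eq_zero_left hw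
    rw [this]
    exact (Module.End.isNilpotent.restrict hmapN h.nilpotent).neg
  have h0 := Module.End.eq_zero_of_isNilpotent_isSemisimple hnil hss
  have := LinearMap.congr_fun h0 ⟨v, hv⟩
  simpa using congrArg Subtype.val this

theorem IsJordanChevalley.nilpotent_apply_eq_zero {A S N : Module.End K V}
    (h : IsJordanChevalley A S N) {v : V} (hv : A v = 0) : N v = 0 := by
  have h1 := h.semisimple_apply_eq_zero hv
  rw [h.eq_add] at hv
  simpa [h1] using hv

/-- Existence of the Jordan–Chevalley decomposition, with components polynomial in `A`. -/
theorem exists_isJordanChevalley [PerfectField K] [FiniteDimensional K V] (A : Module.End K V) :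
    ∃ S ∈ Algebra.adjoin K {A}, ∃ N ∈ Algebra.adjoin K {A}, IsJordanChevalley A S N := by
  obtain ⟨N, hN, S, hS, hn, hs, h⟩ := A.exists_isNilpotent_isSemisimple
  refine ⟨S, hS, N, hN, by rw [h, add_comm], ?_, hs, hn⟩
  exact Algebra.commute_of_mem_adjoin_singleton_of_commute hN
    (Algebra.commute_of_mem_adjoin_self hS).symm

theorem IsJordanChevalley.unique [PerfectField K] [FiniteDimensional K V]
    {A S N S' N' : Module.End K V} (h : IsJordanChevalley A S N) (h' : IsJordanChevalley A S' N') :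
    S = S' ∧ N = N' := by
  have := Module.End.isNilpotent_isSemisimple_unique h.nilpotent h.semisimple h'.nilpotent
    h'.semisimple h.commute.symm h'.commute.symm
    (by rw [add_comm N, add_comm N', ← h.eq_add, ← h'.eq_add])
  exact ⟨this.2, this.1⟩

theorem mem_of_mem_adjoin {A T : Module.End K V} (hT : T ∈ Algebra.adjoin K {A})
    {p : Submodule K V} (hp : ∀ v ∈ p, A v ∈ p) : ∀ v ∈ p, T v ∈ p := by
  induction hT using Algebra.adjoin_induction with
  | mem x hx => rw [Set.mem_singleton_iff.mp hx]; exact hp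
  | algebraMap r => intro v hv; exact p.smul_mem r hv
  | add x y _ _ hx hy => intro v hv; exact p.add_mem (hx v hv) (hy v hv)
  | mul x y _ _ hx hy => intro v hv; exact hx _ (hy v hv)

/-- The operator `φ ↦ S' ∘ φ - φ ∘ S` on `Hom (V, W)`. -/
def homAction (S : Module.End K V) (S' : Module.End K W) : Module.End K (V →ₗ[K] W) :=
  LinearMap.llcomp K V W W S' - LinearMap.lcomp K W S

@[simp]
theorem homAction_apply (S : Module.End K V) (S' : Module.End K W) (φ : V →ₗ[K] W) (v : V) :
    homAction S S' φ v = S' (φ v) - φ (S v) := rfl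

theorem aeval_llcomp_apply (S' : Module.End K W) (p : K[X]) (φ : V →ₗ[K] W) :
    aeval (LinearMap.llcomp K V W W S' : Module.End K (V →ₗ[K] W)) p φ = aeval S' p ∘ₗ φ := by
  induction p using Polynomial.induction_on' with
  | add p q hp hq => rw [map_add, map_add, LinearMap.add_apply, hp, hq, LinearMap.add_comp]
  | monomial n a =>
    rw [aeval_monomial, aeval_monomial]
    induction n generalizing φ with
    | zero => ext; simp
    | succ n ih =>
      rw [pow_succ, ← mul_assoc, Module.End.mul_apply, ih]
      ext; simp [pow_succ]

theorem aeval_lcomp_apply (S : Module.End K V) (p : K[X]) (φ : V →ₗ[K] W) :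
    aeval (LinearMap.lcomp K W S : Module.End K (V →ₗ[K] W)) p φ = φ ∘ₗ aeval S p := by
  induction p using Polynomial.induction_on' with
  | add p q hp hq => rw [map_add, map_add, LinearMap.add_apply, hp, hq, LinearMap.comp_add]
  | monomial n a =>
    rw [aeval_monomial, aeval_monomial]
    induction n generalizing φ with
    | zero => ext; simp
    | succ n ih =>
      rw [pow_succ, ← mul_assoc, Module.End.mul_apply, ih]
      ext; simp [pow_succ']

theorem commute_llcomp_lcomp (S : Module.End K V) (S' : Module.End K W) :
    Commute (LinearMap.llcomp K V W W S' : Module.End K (V →ₗ[K] W)) (LinearMap.lcomp K W S) :=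
  LinearMap.ext fun _ => rfl

theorem isNilpotent_homAction {S : Module.End K V} {S' : Module.End K W}
    (hS : IsNilpotent S) (hS' : IsNilpotent S') : IsNilpotent (homAction S S') := by
  refine (commute_llcomp_lcomp S S').isNilpotent_sub ?_ ?_
  · obtain ⟨k, hk⟩ := hS'
    refine ⟨k, LinearMap.ext fun φ => ?_⟩
    have := aeval_llcomp_apply S' (X ^ k) φ
    simpa [hk] using this
  · obtain ⟨k, hk⟩ := hS
    refine ⟨k, LinearMap.ext fun φ => ?_⟩
    have := aeval_lcomp_apply S (X ^ k) φ
    simpa [hk] using this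

theorem commute_homAction {S N : Module.End K V} {S' N' : Module.End K W}
    (h : Commute S N) (h' : Commute S' N') : Commute (homAction S S') (homAction N N') := by
  refine LinearMap.ext fun φ => LinearMap.ext fun v => ?_
  have h1 : S (N v) = N (S v) := LinearMap.congr_fun h.eq v
  have h2 (w : W) : S' (N' w) = N' (S' w) := LinearMap.congr_fun h'.eq w
  simp only [Module.End.mul_apply, homAction_apply, map_sub, h1, h2]
  abel

theorem isSemisimple_of_surjective [FiniteDimensional K V] {T : Module.End K V} {T' : Module.End K W}
    {φ : V →ₗ[K] W}
    (hφ : Function.Surjective φ) (h : ∀ v, φ (T v) = T' (φ v)) (hT : T.IsSemisimple) :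
    T'.IsSemisimple := by
  refine Module.End.isSemisimple_of_squarefree_aeval_eq_zero hT.minpoly_squarefree ?_
  ext w
  obtain ⟨v, rfl⟩ := hφ w
  rw [← aeval_intertwine h, minpoly.aeval]; simp

theorem isSemisimple_of_injective [FiniteDimensional K W] {T : Module.End K V} {T' : Module.End K W}
    {φ : V →ₗ[K] W}
    (hφ : Function.Injective φ) (h : ∀ v, φ (T v) = T' (φ v)) (hT' : T'.IsSemisimple) :
    T.IsSemisimple := by
  refine Module.End.isSemisimple_of_squarefree_aeval_eq_zero hT'.minpoly_squarefree ?_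
  ext v
  apply hφ
  rw [aeval_intertwine h, minpoly.aeval]; simp

variable [FiniteDimensional K V] [FiniteDimensional K W]

theorem isSemisimple_homAction [PerfectField K] {S : Module.End K V} {S' : Module.End K W}
    (hS : S.IsSemisimple) (hS' : S'.IsSemisimple) : (homAction S S').IsSemisimple := by
  refine Module.End.IsSemisimple.sub_of_commute (commute_llcomp_lcomp S S') ?_ ?_
  · refine Module.End.isSemisimple_of_squarefree_aeval_eq_zero hS'.minpoly_squarefree ?_
    ext φ v
    rw [aeval_llcomp_apply, minpoly.aeval]; rfl
  · refine Module.End.isSemisimple_of_squarefree_aeval_eq_zero hS.minpoly_squarefree ?_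
    ext φ v
    rw [aeval_lcomp_apply, minpoly.aeval]; simp

theorem IsJordanChevalley.homAction [PerfectField K] {A S N : Module.End K V}
    {A' S' N' : Module.End K W} (h : IsJordanChevalley A S N) (h' : IsJordanChevalley A' S' N') :
    IsJordanChevalley (homAction A A') (GradedLie.homAction S S') (GradedLie.homAction N N') where
  eq_add := by
    ext φ v
    simp only [h.eq_add, h'.eq_add, homAction_apply, LinearMap.add_apply, map_add]
    abel
  commute := commute_homAction h.commute h'.commute
  semisimple := isSemisimple_homAction h.semisimple h'.semisimple
  nilpotent := isNilpotent_homAction h.nilpotent h'.nilpotent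

/-- A linear map intertwining two endomorphisms intertwines their Jordan–Chevalley components. -/
theorem IsJordanChevalley.intertwine [PerfectField K] {A S N : Module.End K V}
    {A' S' N' : Module.End K W} (h : IsJordanChevalley A S N) (h' : IsJordanChevalley A' S' N')
    {φ : V →ₗ[K] W} (hφ : ∀ v, φ (A v) = A' (φ v)) (v : V) :
    φ (S v) = S' (φ v) ∧ φ (N v) = N' (φ v) := by
  -- Intertwining means that `φ` lies in the kernel of `homAction A A'`; the Jordan–Chevalley parts
  -- of that operator therefore kill `φ` too.
  have h0 : GradedLie.homAction A A' φ = 0 := by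
    ext v; simp [hφ]
  have h1 := LinearMap.congr_fun ((h.homAction h').semisimple_apply_eq_zero h0) v
  have h2 := LinearMap.congr_fun ((h.homAction h').nilpotent_apply_eq_zero h0) v
  exact ⟨(sub_eq_zero.mp h1).symm, (sub_eq_zero.mp h2).symm⟩

/-- If `T` is semisimple, `U` is nilpotent and they commute, `V` is the sum of the kernel of `T`
and the range of `T + U`. -/
theorem ker_sup_range_add_eq_top {T U : Module.End K V} (hT : T.IsSemisimple) (hU : IsNilpotent U)
    (hTU : Commute T U) : LinearMap.ker T ⊔ LinearMap.range (T + U) = ⊤ := by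
  set A := T + U with hA
  -- Fitting decomposition of `A = T + U`: on the generalized kernel `A` is nilpotent, so `T = A -
  -- U` is nilpotent as well as semisimple, hence zero there.
  obtain ⟨m, hm⟩ := (LinearMap.eventually_isCompl_ker_pow_range_pow A).exists_forall_of_atTop
  have hc := hm (m + 1) (Nat.le_succ m)
  rw [eq_top_iff, ← hc.sup_eq_top]
  refine sup_le_sup ?_ ?_
  · have hAT : Commute A T := (Commute.refl T).add_left hTU.symm
    have hAU : Commute A U := hTU.add_left (Commute.refl U)
    have hst (B : Module.End K V) (hB : Commute A B) :
        ∀ w ∈ LinearMap.ker (A ^ (m + 1)), B w ∈ LinearMap.ker (A ^ (m + 1)) := by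
      intro w hw
      have : (A ^ (m + 1)) (B w) = B ((A ^ (m + 1)) w) :=
        LinearMap.congr_fun (hB.pow_left (m + 1)).eq w
      rw [LinearMap.mem_ker] at hw ⊢
      rw [this, hw, map_zero]
    have hnil : IsNilpotent (A.restrict (hst A (Commute.refl A))) := by
      refine ⟨m + 1, LinearMap.ext fun w => Subtype.ext ?_⟩
      rw [Module.End.pow_restrict]
      exact w.2
    have hT0 : T.restrict (hst T hAT) = 0 := by
      refine Module.End.eq_zero_of_isNilpotent_isSemisimple ?_ (hT.restrict (hst T hAT))
      have : T.restrict (hst T hAT) = A.restrict (hst A (Commute.refl A)) -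
          U.restrict (hst U hAU) := by
        ext w; simp [hA]
      rw [this]
      refine Commute.isNilpotent_sub ?_ hnil (Module.End.isNilpotent.restrict _ hU)
      exact LinearMap.restrict_commute hAU _ _
    intro v hv
    exact congrArg Subtype.val (LinearMap.congr_fun hT0 ⟨v, hv⟩)
  · rw [pow_succ']
    exact LinearMap.range_comp_le_range _ _

/-- The splitting above inside a stable subspace `p`. With `U = 0` it replaces `v` by an element
killed by `T`, modulo the image of `T` on `p`, and so plays the role of averaging. -/
theorem exists_ker_add_apply {T U : Module.End K V} (hT : T.IsSemisimple) (hU : IsNilpotent U)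
    (hTU : Commute T U) {p : Submodule K V} (hpT : ∀ v ∈ p, T v ∈ p) (hpU : ∀ v ∈ p, U v ∈ p)
    {v : V} (hv : v ∈ p) : ∃ u ∈ p, ∃ w ∈ p, T u = 0 ∧ v = u + (T w + U w) := by
  have h := ker_sup_range_add_eq_top (hT.restrict hpT) (Module.End.isNilpotent.restrict hpU hU)
    (LinearMap.restrict_commute hTU hpT hpU)
  have hm : (⟨v, hv⟩ : p) ∈ LinearMap.ker (T.restrict hpT) ⊔
      LinearMap.range (T.restrict hpT + U.restrict hpU) := by rw [h]; exact Submodule.mem_top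
  obtain ⟨u, hu, _, ⟨w, rfl⟩, huw⟩ := Submodule.mem_sup.mp hm
  exact ⟨u, u.2, w, w.2, congrArg Subtype.val hu, (congrArg Subtype.val huw).symm⟩

end LinearAlgebra

end GradedLie

namespace GradedLie

open LieModule

/-! ### Casimir operators and Weyl's complete reducibility. -/

section Casimir

variable {K L : Type*} [Field K] [LieRing L] [LieAlgebra K L]

/-- A Lie algebra with nondegenerate Killing form is perfect. -/
theorem lie_top_top_eq_top [FiniteDimensional K L] [LieAlgebra.IsKilling K L] :
    ⁅(⊤ : LieIdeal K L), (⊤ : LieIdeal K L)⁆ = ⊤ := by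
  set D : LieIdeal K L := ⁅(⊤ : LieIdeal K L), (⊤ : LieIdeal K L)⁆
  have h := LieIdeal.isCompl_killingCompl D
  have hbot : LieIdeal.killingCompl K L D = ⊥ := by
    -- By invariance, an element orthogonal to all brackets has its own brackets in the kernel of
    -- the Killing form, so it is central.
    rw [eq_bot_iff]
    intro x hx
    rw [LieIdeal.mem_killingCompl] at hx
    have h1 : ∀ y : L, ⁅y, x⁆ = 0 := by
      intro y
      have : ⁅y, x⁆ ∈ LinearMap.ker (killingForm K L) := by
        rw [LinearMap.mem_ker]
        ext z
        rw [LieModule.traceForm_comm, ← LieModule.traceForm_apply_lie_apply]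
        exact hx _ (LieSubmodule.lie_mem_lie (LieSubmodule.mem_top z) (LieSubmodule.mem_top y))
      simpa using this
    have : x ∈ LieAlgebra.center K L := h1
    simpa using this
  have := h.sup_eq_top
  rwa [hbot, sup_bot_eq] at this

variable {ι : Type*} [Fintype ι]

/-- The Casimir endomorphism `∑ eᵢ fᵢ` of a module. -/
def casimir (M : Type*) [AddCommGroup M] [Module K M] [LieRingModule L M] [LieModule K L M]
    (e f : ι → L) : Module.End K M :=
  ∑ i, toEnd K L M (e i) * toEnd K L M (f i)

variable {M : Type*} [AddCommGroup M] [Module K M] [LieRingModule L M] [LieModule K L M]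

theorem casimir_apply (e f : ι → L) (m : M) :
    casimir (K := K) M e f m = ∑ i, ⁅e i, ⁅f i, m⁆⁆ := by
  simp [casimir]

/-- `x` acts on `e` by a matrix and on `f` by minus its transpose, so the two double sums cancel. -/
theorem lie_casimir_apply {e f : ι → L} {x : L} {a : ι → ι → K}
    (he : ∀ i, ⁅x, e i⁆ = ∑ j, a i j • e j) (hf : ∀ i, ⁅x, f i⁆ = - ∑ j, a j i • f j) (m : M) :
    ⁅x, casimir (K := K) M e f m⁆ = casimir (K := K) M e f ⁅x, m⁆ := by
  rw [← sub_eq_zero, casimir_apply, casimir_apply, lie_sum, ← Finset.sum_sub_distrib]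
  have h1 : ∀ i, ⁅x, ⁅e i, ⁅f i, m⁆⁆⁆ - ⁅e i, ⁅f i, ⁅x, m⁆⁆⁆ =
      (∑ j, a i j • ⁅e j, ⁅f i, m⁆⁆) - ∑ j, a j i • ⁅e i, ⁅f j, m⁆⁆ := by
    intro i
    have h2 : ⁅⁅x, e i⁆, ⁅f i, m⁆⁆ = ∑ j, a i j • ⁅e j, ⁅f i, m⁆⁆ := by
      rw [he, sum_lie]; simp
    have h3 : ⁅e i, ⁅⁅x, f i⁆, m⁆⁆ = - ∑ j, a j i • ⁅e i, ⁅f j, m⁆⁆ := by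
      rw [hf, neg_lie, sum_lie, lie_neg, lie_sum]; simp
    rw [leibniz_lie x, leibniz_lie x (f i), lie_add, h2, h3]
    abel
  rw [Finset.sum_congr rfl fun i _ => h1 i, Finset.sum_sub_distrib, Finset.sum_comm, sub_self]

variable [FiniteDimensional K L]

/-- Dual bases of an ideal for an invariant form nondegenerate on it. -/
theorem exists_dual_bases (B : LinearMap.BilinForm K L) (hB : B.lieInvariant L) (hsymm : ∀ x y, B x y = B y x)
    (I : LieIdeal K L) (hI : ∀ x ∈ I, (∀ y ∈ I, B x y = 0) → x = 0) :
    ∃ e f : Fin (Module.finrank K I) → L, (∀ i, B (e i) (f i) = 1) ∧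
      ∀ x : L, ∃ a : Fin (Module.finrank K I) → Fin (Module.finrank K I) → K,
        (∀ i, ⁅x, e i⁆ = ∑ j, a i j • e j) ∧ (∀ i, ⁅x, f i⁆ = - ∑ j, a j i • f j) := by
  classical
  let BI : LinearMap.BilinForm K I := B.restrict I.toSubmodule
  have hBIs : BI.IsSymm := ⟨fun x y => hsymm x y⟩
  have hBI : BI.Nondegenerate := by
    refine (LinearMap.BilinForm.IsSymm.isRefl hBIs).nondegenerate_iff_separatingLeft.mpr ?_
    intro x hx
    exact Subtype.ext (hI x x.2 fun y hy => hx ⟨y, hy⟩)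
  let b := Module.finBasis K I
  let d := BI.dualBasis hBI b
  have hd : ∀ v : I, v = ∑ j, B v (b j) • d j := by
    intro v
    conv_lhs => rw [← d.sum_repr v]
    refine Finset.sum_congr rfl fun j _ => ?_
    rw [LinearMap.BilinForm.dualBasis_repr_apply]; rfl
  have hb : ∀ v : I, v = ∑ j, B v (d j) • b j := by
    intro v
    have h0 : ∀ w : I, BI v w = BI (∑ j, B v (d j) • b j) w := by
      intro w
      have : w = ∑ j, B w (b j) • d j := hd w
      rw [this]
      simp only [map_sum, map_smul, LinearMap.sum_apply, LinearMap.smul_apply]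
      refine Finset.sum_congr rfl fun j _ => ?_
      congr 1
      have h2 : ∀ i, BI (b i) (d j) = if i = j then 1 else 0 :=
        fun i => LinearMap.BilinForm.apply_dualBasis_right hBI hBIs b i j
      simp [h2]
      rfl
    have h1 : v - ∑ j, B v (d j) • b j = 0 :=
      hBI.1 _ fun w => by rw [map_sub, LinearMap.sub_apply, h0 w, sub_self]
    exact sub_eq_zero.mp h1
  refine ⟨fun i => b i, fun i => d i, fun i => ?_, fun x =>
    ⟨fun i j => B ⁅x, (b i : L)⁆ (d j), fun i => ?_, fun i => ?_⟩⟩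
  · have := LinearMap.BilinForm.apply_dualBasis_right hBI hBIs b i i
    rwa [if_pos rfl] at this
  · have := congrArg Subtype.val (hb ⁅x, b i⁆)
    simpa using this
  · have := congrArg Subtype.val (hd ⁅x, d i⁆)
    simp only [LieSubmodule.coe_bracket] at this
    rw [this]
    simp only [AddSubmonoidClass.coe_finsetSum, LieSubmodule.coe_smul]
    rw [← Finset.sum_neg_distrib]
    refine Finset.sum_congr rfl fun j _ => ?_
    rw [hB, hsymm, ← neg_smul]

variable [CharZero K] [FiniteDimensional K M]

/-- If `L` has nondegenerate Killing form and acts trivially on `m` modulo a submodule `N`, then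
`m` can be corrected by an element of `N` so as to become invariant. -/
theorem exists_sub_invariant [LieAlgebra.IsKilling K L] (N : LieSubmodule K L M) (m : M)
    (hm : ∀ x : L, ⁅x, m⁆ ∈ N) : ∃ n ∈ N, ∀ x : L, ⁅x, m - n⁆ = 0 := by
  have : WellFoundedLT (LieSubmodule K L M) := LieSubmodule.wellFoundedLT_of_isArtinian K L M
  induction N using WellFoundedLT.induction generalizing m with
  | ind N ih =>
  -- It suffices to push the values `⁅x, m⁆` into a strictly smaller submodule after correcting `m`
  -- by an element of `N`; well-founded induction does the rest. The remaining case is shown to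
  -- contradict the failure of this.
  by_cases hex : ∃ n ∈ N, ∃ N' < N, ∀ x : L, ⁅x, m - n⁆ ∈ N'
  · obtain ⟨n, hn, N', hN', h⟩ := hex
    obtain ⟨n', hn', h'⟩ := ih N' hN' (m - n) h
    exact ⟨n + n', N.add_mem hn (hN'.le hn'), fun x => by rw [← sub_sub]; exact h' x⟩
  by_cases hbot : N = ⊥
  · exact ⟨0, N.zero_mem, fun x => by simpa [hbot] using hm x⟩
  exfalso
  apply hex
  have hnt : Nontrivial N := (LieSubmodule.nontrivial_iff_ne_bot K L M).mpr hbot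
  -- If the trace form of `N` vanishes, perfectness of `L` makes `N` a nilpotent module, so `⁅L, N⁆
  -- < N`; and since `L` is spanned by brackets, it already maps `m` into `⁅L, N⁆`.
  by_cases htr : traceForm K L N = 0
  · have hnil := isNilpotent_derivedSeries_of_traceForm_eq_zero htr
    have hder : LieAlgebra.derivedSeries K L 1 = ⊤ := by
      rw [LieAlgebra.derivedSeries_def, LieAlgebra.derivedSeriesOfIdeal_succ,
        LieAlgebra.derivedSeriesOfIdeal_zero, lie_top_top_eq_top]
    have hnil' : LieModule.IsNilpotent L N := by
      rw [isNilpotent_iff_forall' (R := K)] at hnil ⊢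
      intro x
      exact hnil ⟨x, by rw [hder]; exact LieSubmodule.mem_top x⟩
    refine ⟨0, N.zero_mem, ⁅(⊤ : LieIdeal K L), N⁆, ?_, ?_⟩
    · refine lt_of_le_of_ne (LieSubmodule.lie_le_right _ _) fun heq => ?_
      obtain ⟨k, hk⟩ := (LieSubmodule.isNilpotent_iff_exists_lcs_eq_bot (R := K) N).mp hnil'
      have : ∀ k, N.lcs k = N := by
        intro k
        induction k with
        | zero => rfl
        | succ k ih => rw [LieSubmodule.lcs_succ, ih, heq]
      exact hbot ((this k).symm.trans hk)
    · intro x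
      rw [sub_zero]
      have hx : x ∈ ⁅(⊤ : LieIdeal K L), (⊤ : LieIdeal K L)⁆ := by
        rw [lie_top_top_eq_top]; exact LieSubmodule.mem_top x
      rw [← LieSubmodule.mem_toSubmodule, LieSubmodule.lieIdeal_oper_eq_linear_span'] at hx
      induction hx using Submodule.span_induction with
      | mem x hx =>
        obtain ⟨y, -, z, -, rfl⟩ := hx
        rw [lie_lie]
        exact Submodule.sub_mem (LieSubmodule.toSubmodule _)
          (LieSubmodule.lie_mem_lie (LieSubmodule.mem_top y) (hm z))
          (LieSubmodule.lie_mem_lie (LieSubmodule.mem_top z) (hm y))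
      | zero => rw [zero_lie]; exact LieSubmodule.zero_mem _
      | add x y _ _ hx hy => rw [add_lie]; exact Submodule.add_mem (LieSubmodule.toSubmodule _) hx hy
      | smul a x _ hx => rw [smul_lie]; exact Submodule.smul_mem (LieSubmodule.toSubmodule _) _ hx
  · have hinv := traceForm_lieInvariant K L N
    set k : LieIdeal K L := LieAlgebra.InvariantForm.orthogonal (traceForm K L N) hinv ⊤ with hk
    have hkmem : ∀ x, x ∈ k ↔ ∀ y, traceForm K L N x y = 0 := by
      intro x
      rw [hk, LieAlgebra.InvariantForm.mem_orthogonal]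
      exact ⟨fun h y => by rw [traceForm_comm]; exact h y (LieSubmodule.mem_top y),
        fun h y _ => by rw [traceForm_comm]; exact h y⟩
    -- The trace form is nondegenerate on a complement `I` of its kernel. The Casimir element of `I`
    -- has trace `dim I ≠ 0` on `N`, so it is not nilpotent there.
    obtain ⟨I, hI⟩ := exists_isCompl k
    have hIne : Module.finrank K I ≠ 0 := by
      intro h0
      have hI0 : I = ⊥ := by
        rw [← LieSubmodule.toSubmodule_eq_bot]
        exact Submodule.finrank_eq_zero.mp h0
      have : k = ⊤ := by simpa [hI0] using hI.sup_eq_top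
      apply htr
      ext x y
      exact (hkmem x).mp (by rw [this]; exact LieSubmodule.mem_top x) y
    obtain ⟨e, f, hef, hstr⟩ := exists_dual_bases (traceForm K L N) hinv
      (traceForm_comm K L N) I (by
        intro x hx hxy
        have : x ∈ k := by
          rw [hkmem]
          intro y
          have hy : y ∈ k ⊔ I := by rw [hI.sup_eq_top]; exact LieSubmodule.mem_top y
          obtain ⟨u, hu, v, hv, rfl⟩ := LieSubmodule.mem_sup _ _ _ |>.mp hy
          rw [map_add, hxy v hv, add_zero, traceForm_comm]
          exact (hkmem u).mp hu x
        have h0 : x ∈ k ⊓ I := ⟨this, hx⟩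
        rw [hI.inf_eq_bot] at h0
        simpa using h0)
    set C := casimir (K := K) M e f with hC
    set CN := casimir (K := K) N e f with hCN
    have hCcomm : ∀ (x : L) (m : M), ⁅x, C m⁆ = C ⁅x, m⁆ := by
      intro x m
      obtain ⟨a, h1, h2⟩ := hstr x
      exact lie_casimir_apply h1 h2 m
    have hCNcoe : ∀ n : N, (CN n : M) = C n := by
      intro n; rw [hC, hCN, casimir_apply, casimir_apply]; simp
    have hCm : C m ∈ N := by
      rw [hC, casimir_apply]
      exact N.toSubmodule.sum_mem fun i _ => N.lie_mem (hm (f i))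
    have htrace : LinearMap.trace K N CN ≠ 0 := by
      have : LinearMap.trace K N CN = Module.finrank K I := by
        rw [hCN, casimir, map_sum]
        refine (Finset.sum_congr rfl fun i _ => hef i).trans ?_
        simp
      rw [this]; exact_mod_cast hIne
    have hnotnil : ¬ IsNilpotent CN := fun h =>
      htrace (LinearMap.isNilpotent_trace_of_isNilpotent h).eq_zero
    obtain ⟨j, hj⟩ := (LinearMap.eventually_isCompl_ker_pow_range_pow CN).exists_forall_of_atTop
    have hsup := (hj (j + 1) (Nat.le_succ j)).sup_eq_top
    have hmem : (⟨C m, hCm⟩ : N) ∈ LinearMap.ker (CN ^ (j + 1)) ⊔ LinearMap.range (CN ^ (j + 1)) := by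
      rw [hsup]; exact Submodule.mem_top
    obtain ⟨n0, hn0, n1, ⟨n2, hn2⟩, hsum⟩ := Submodule.mem_sup.mp hmem
    have hpow : ∀ (i : ℕ) (n : N), ((CN ^ i) n : M) = (C ^ i) n := by
      intro i
      induction i with
      | zero => intro n; rfl
      | succ i ih =>
        intro n
        rw [pow_succ, pow_succ, Module.End.mul_apply, Module.End.mul_apply, ih, hCNcoe]
    have hpowcomm : ∀ (i : ℕ) (x : L) (m : M), ⁅x, (C ^ i) m⁆ = (C ^ i) ⁅x, m⁆ := by
      intro i
      induction i with
      | zero => intro x m; rfl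
      | succ i ih =>
        intro x m
        rw [pow_succ', Module.End.mul_apply, Module.End.mul_apply, hCcomm, ih]
    -- Fitting's lemma writes `C m = n0 + C ^ (j + 1) n2`. Subtracting `n3 = C ^ j n2` from `m`
    -- leaves `C (m - n3) = n0`, which is killed by `C ^ (j + 1)`; hence the exponent `j + 2` below.
    set n3 : N := (CN ^ j) n2 with hn3
    have hn3' : CN n3 = n1 := by rw [hn3, ← Module.End.mul_apply, ← pow_succ', hn2]
    have hkey : (C ^ (j + 2)) (m - n3) = 0 := by
      have h1 : C (m - n3) = n0 := by
        rw [map_sub, ← hCNcoe, hn3']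
        have := congrArg Subtype.val hsum
        simp only at this
        rw [← this]; simp
      rw [pow_succ, Module.End.mul_apply, h1, ← hpow, LinearMap.mem_ker.mp hn0]; rfl
    let N' : LieSubmodule K L M :=
      { N.toSubmodule ⊓ LinearMap.ker (C ^ (j + 2)) with
        lie_mem := by
          rintro x m ⟨h1, h2⟩
          refine ⟨N.lie_mem h1, ?_⟩
          have h2' : (C ^ (j + 2)) m = 0 := h2
          change (C ^ (j + 2)) ⁅x, m⁆ = 0
          rw [← hpowcomm, h2', lie_zero] }
    refine ⟨n3, n3.2, N', ?_, fun x' => ⟨?_, ?_⟩⟩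
    · refine lt_of_le_of_ne (fun x hx => hx.1) fun heq => hnotnil ⟨j + 2, ?_⟩
      refine LinearMap.ext fun n => Subtype.ext ?_
      have hn : (n : M) ∈ N' := by rw [heq]; exact n.2
      rw [hpow]
      exact hn.2
    · rw [lie_sub]
      exact N.sub_mem (hm x') (N.lie_mem n3.2)
    · change (C ^ (j + 2)) ⁅x', m - (n3 : M)⁆ = 0
      rw [← hpowcomm, hkey, lie_zero]

/-- **Weyl's theorem**: submodules have invariant complements. -/
theorem exists_isCompl_lieSubmodule [LieAlgebra.IsKilling K L] (N : LieSubmodule K L M) :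
    ∃ N' : LieSubmodule K L M, IsCompl N.toSubmodule N'.toSubmodule := by
  -- A linear projection onto `N` is invariant modulo the maps into `N` that vanish on `N`.
  -- Correcting it inside `Q` gives an invariant projection, whose kernel is the complement.
  let Q : LieSubmodule K L (M →ₗ[K] M) :=
    { carrier := {φ | (∀ m, φ m ∈ N) ∧ ∀ m ∈ N, φ m = 0}
      zero_mem' := ⟨fun _ => N.zero_mem, fun _ _ => rfl⟩
      add_mem' := fun h h' => ⟨fun m => N.add_mem (h.1 m) (h'.1 m), fun m hm => by
        rw [LinearMap.add_apply, h.2 m hm, h'.2 m hm, add_zero]⟩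
      smul_mem' := fun c φ h => ⟨fun m => N.smul_mem c (h.1 m), fun m hm => by
        rw [LinearMap.smul_apply, h.2 m hm, smul_zero]⟩
      lie_mem := fun {x φ} h => ⟨fun m => N.sub_mem (N.lie_mem (h.1 m)) (h.1 _), fun m hm => by
        rw [LieHom.lie_apply, h.2 m hm, h.2 _ (N.lie_mem hm), lie_zero, sub_zero]⟩ }
  obtain ⟨p, hp⟩ := Submodule.exists_isCompl N.toSubmodule
  let φ : M →ₗ[K] M := N.toSubmodule.subtype ∘ₗ Submodule.projectionOnto _ _ hp
  have hφN : ∀ m, φ m ∈ N := fun m => (Submodule.projectionOnto _ _ hp m).2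
  have hφid : ∀ m ∈ N, φ m = m := fun m hm =>
    congrArg Subtype.val (Submodule.projectionOnto_apply_left hp ⟨m, hm⟩)
  obtain ⟨ψ, hψ, hinv⟩ := exists_sub_invariant Q φ (fun x => ⟨fun m =>
    N.sub_mem (N.lie_mem (hφN m)) (hφN _), fun m hm => by
      rw [LieHom.lie_apply, hφid m hm, hφid _ (N.lie_mem hm), sub_self]⟩)
  set π := φ - ψ
  have hπN : ∀ m, π m ∈ N := fun m => N.sub_mem (hφN m) (hψ.1 m)
  have hπid : ∀ m ∈ N, π m = m := fun m hm => by
    change φ m - ψ m = m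
    rw [hφid m hm, hψ.2 m hm, sub_zero]
  refine ⟨{ LinearMap.ker π with
      lie_mem := fun {x m} hm => ?_ }, ?_⟩
  · have hm' : π m = 0 := hm
    change π ⁅x, m⁆ = 0
    have := LinearMap.congr_fun (hinv x) m
    rw [LieHom.lie_apply, hm', lie_zero, zero_sub, LinearMap.zero_apply, neg_eq_zero] at this
    exact this
  · refine ⟨?_, ?_⟩
    · rw [Submodule.disjoint_def]
      intro m hm hm'
      rw [← hπid m hm]; exact hm'
    · rw [codisjoint_iff, eq_top_iff]
      intro m _
      refine Submodule.mem_sup.mpr ⟨π m, hπN m, m - π m, ?_, by abel⟩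
      change π (m - π m) = 0
      rw [map_sub, hπid _ (hπN m), sub_self]

end Casimir

end GradedLie

namespace GradedLie

open LieModule

/-! ### Correction to invariants, for quotients and modulo a submodule. -/

section Invariants

variable {K L M : Type*} [Field K] [LieRing L] [LieAlgebra K L]
  [AddCommGroup M] [Module K M] [LieRingModule L M] [LieModule K L M]

/-- The representation of a quotient Lie algebra induced by a module killed by the ideal. -/
def quotientToEnd (a : LieIdeal K L) (h : ∀ x ∈ a, ∀ m : M, ⁅x, m⁆ = 0) :
    (L ⧸ a) →ₗ⁅K⁆ Module.End K M :=
  { a.toSubmodule.liftQ (toEnd K L M : L →ₗ[K] Module.End K M)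
      (fun x hx => LinearMap.ext fun m => h x hx m) with
    map_lie' := by
      intro x y
      obtain ⟨x, rfl⟩ := LieSubmodule.Quotient.surjective_mk' a x
      obtain ⟨y, rfl⟩ := LieSubmodule.Quotient.surjective_mk' a y
      exact (toEnd K L M).map_lie x y }

variable [FiniteDimensional K L] [CharZero K] [FiniteDimensional K M]

theorem exists_sub_invariant_of_quotient (a : LieIdeal K L) [LieAlgebra.IsKilling K (L ⧸ a)]
    (h : ∀ x ∈ a, ∀ m : M, ⁅x, m⁆ = 0) (N : LieSubmodule K L M) (m : M)
    (hm : ∀ x : L, ⁅x, m⁆ ∈ N) : ∃ n ∈ N, ∀ x : L, ⁅x, m - n⁆ = 0 := by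
  let _ : LieRingModule (L ⧸ a) M := LieRingModule.compLieHom M (quotientToEnd a h)
  let _ : LieModule K (L ⧸ a) M := LieModule.compLieHom M (quotientToEnd a h)
  have hact : ∀ (x : L) (m : M), ⁅(LieSubmodule.Quotient.mk x : L ⧸ a), m⁆ = ⁅x, m⁆ :=
    fun x m => rfl
  have : FiniteDimensional K (L ⧸ a) :=
    Module.Finite.of_surjective (LieSubmodule.Quotient.mk' a : L →ₗ[K] L ⧸ a)
      (LieSubmodule.Quotient.surjective_mk' a)
  let N' : LieSubmodule K (L ⧸ a) M :=
    { N.toSubmodule with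
      lie_mem := by
        intro x m hm
        obtain ⟨x, rfl⟩ := LieSubmodule.Quotient.surjective_mk' a x
        exact N.lie_mem hm }
  obtain ⟨n, hn, hinv⟩ := exists_sub_invariant N' m (by
    intro x
    obtain ⟨x, rfl⟩ := LieSubmodule.Quotient.surjective_mk' a x
    exact hm x)
  exact ⟨n, hn, fun x => hinv (LieSubmodule.Quotient.mk x)⟩

/-- A relative version of `exists_sub_invariant`: modulo a submodule `R` containing `a • M`. -/
theorem exists_sub_lie_mem (a : LieIdeal K L) [LieAlgebra.IsKilling K (L ⧸ a)]
    (R N : LieSubmodule K L M) (hR : ∀ x ∈ a, ∀ m : M, ⁅x, m⁆ ∈ R) (m : M)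
    (hm : ∀ x : L, ⁅x, m⁆ ∈ N) : ∃ n ∈ N, ∀ x : L, ⁅x, m - n⁆ ∈ R := by
  have : FiniteDimensional K (M ⧸ R) :=
    Module.Finite.of_surjective (LieSubmodule.Quotient.mk' R : M →ₗ[K] M ⧸ R)
      (LieSubmodule.Quotient.surjective_mk' R)
  obtain ⟨n, hn, h⟩ := exists_sub_invariant_of_quotient (M := M ⧸ R) a (by
      intro x hx m
      obtain ⟨m, rfl⟩ := LieSubmodule.Quotient.surjective_mk' R m
      rw [← LieModuleHom.map_lie]
      exact (LieSubmodule.Quotient.mk_eq_zero (N := R)).mpr (hR x hx m))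
    (N.map (LieSubmodule.Quotient.mk' R)) (LieSubmodule.Quotient.mk' R m) (by
      intro x
      rw [← LieModuleHom.map_lie]
      exact LieSubmodule.mem_map_of_mem (hm x))
  obtain ⟨n, hn', rfl⟩ := (LieSubmodule.mem_map _).mp hn
  refine ⟨n, hn', fun x => ?_⟩
  rw [← LieSubmodule.Quotient.mk_eq_zero (N := R), LieModuleHom.map_lie, map_sub]
  exact h x

end Invariants

/-! ### Solvable ideals and nilpotent action. -/

section Nilpotency

variable {K L M : Type*} [Field K] [LieRing L] [LieAlgebra K L]
  [AddCommGroup M] [Module K M]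

theorem trace_commutator_mul {A Y b : Module.End K M} (h : Commute A b) :
    LinearMap.trace K M ((Y * A - A * Y) * b) = 0 := by
  rw [sub_mul, map_sub, mul_assoc A, LinearMap.trace_mul_comm K A, mul_assoc Y, mul_assoc Y, h.eq,
    sub_self]

variable [LieRingModule L M] [LieModule K L M]
variable [FiniteDimensional K M]

/-- An ideal acting by nilpotent endomorphisms acts trivially on an irreducible module. -/
theorem lie_eq_zero_of_forall_isNilpotent (hirr : ∀ N : LieSubmodule K L M, N = ⊥ ∨ N = ⊤)
    (J : LieIdeal K L) (hJ : ∀ x ∈ J, IsNilpotent (toEnd K L M x)) :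
    ∀ x ∈ J, ∀ m : M, ⁅x, m⁆ = 0 := by
  rcases subsingleton_or_nontrivial M with hM | hM
  · exact fun x _ m => Subsingleton.elim _ _
  -- The `J`-invariants form an `L`-submodule, nonzero by Engel's theorem.
  let N : LieSubmodule K L M :=
    { carrier := {m | ∀ x ∈ J, ⁅x, m⁆ = 0}
      zero_mem' := fun x _ => lie_zero x
      add_mem' := fun h h' x hx => by rw [lie_add, h x hx, h' x hx, add_zero]
      smul_mem' := fun c m h x hx => by rw [lie_smul, h x hx, smul_zero]
      lie_mem := fun {y m} h x hx => by
        rw [leibniz_lie, h x hx, lie_zero, add_zero]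
        exact h _ (lie_mem_left K L J x y hx) }
  have hnil : LieModule.IsNilpotent J M :=
    (isNilpotent_iff_forall' (R := K)).mpr fun x => hJ x x.2
  have hnt := nontrivial_max_triv_of_isNilpotent K J M
  obtain ⟨m, hm⟩ := exists_ne (0 : maxTrivSubmodule K J M)
  have hmN : (m : M) ∈ N := fun x hx => m.2 ⟨x, hx⟩
  rcases hirr N with h | h
  · rw [h, LieSubmodule.mem_bot] at hmN
    exact absurd (Subtype.ext hmN) hm
  · intro x hx m
    have : m ∈ N := by rw [h]; exact LieSubmodule.mem_top m
    exact this x hx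

variable [CharZero K]

/-- An element of `[I, J]` whose action commutes with that of `J` acts nilpotently. -/
theorem isNilpotent_toEnd_of_mem_lie {I J : LieIdeal K L} {x : L} (hx : x ∈ ⁅I, J⁆)
    (hc : ∀ a ∈ J, Commute (toEnd K L M a) (toEnd K L M x)) : IsNilpotent (toEnd K L M x) := by
  refine isNilpotent_of_trace_mul_aeval _ fun p => ?_
  set b := Polynomial.aeval (toEnd K L M x) p with hb
  have hcb : ∀ a ∈ J, Commute (toEnd K L M a) b := fun a ha =>
    Algebra.commute_of_mem_adjoin_singleton_of_commute (Polynomial.aeval_mem_adjoin_singleton K _)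
      (hc a ha)
  rw [← LieSubmodule.mem_toSubmodule, LieSubmodule.lieIdeal_oper_eq_linear_span'] at hx
  -- With `b` fixed, the trace identity is linear in `x` and may be checked on brackets.
  clear_value b
  clear hb
  clear hc
  induction hx using Submodule.span_induction with
  | mem z hz =>
    obtain ⟨y, -, a, ha, rfl⟩ := hz
    rw [LieHom.map_lie, LieRing.of_associative_ring_bracket]
    exact trace_commutator_mul (hcb a ha)
  | zero => simp
  | add x y _ _ hx hy => rw [map_add, add_mul, map_add, hx, hy, add_zero]
  | smul c x _ hx => rw [map_smul, smul_mul_assoc, map_smul, hx, smul_zero]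

/-- `ad`-nilpotent elements of a Lie algebra with nondegenerate Killing form act nilpotently on all
finite-dimensional modules. -/
theorem isNilpotent_toEnd_of_isNilpotent_ad [FiniteDimensional K L] [LieAlgebra.IsKilling K L]
    {z : L} (hz : IsNilpotent (LieAlgebra.ad K L z)) : IsNilpotent (toEnd K L M z) := by
  -- If `y` is Killing-orthogonal to `[z, L]`, invariance gives `[z, y] = 0`, so `ad y * ad z` is
  -- nilpotent and `y` is orthogonal to `z`. Double orthogonality yields `z = [z, h]`, and the trace
  -- criterion then applies in every module.
  have hmem : z ∈ LinearMap.range (LieAlgebra.ad K L z : L →ₗ[K] L) := by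
    rw [← LinearMap.BilinForm.orthogonal_orthogonal
      (LieAlgebra.IsKilling.killingForm_nondegenerate K L)
      (LieModule.traceForm_isSymm K L L).isRefl (LinearMap.range _)]
    rw [LinearMap.BilinForm.mem_orthogonal_iff]
    intro y hy
    rw [LinearMap.BilinForm.mem_orthogonal_iff] at hy
    have h1 : ⁅z, y⁆ = 0 := by
      have : ⁅z, y⁆ ∈ LinearMap.ker (killingForm K L) := by
        rw [LinearMap.mem_ker]
        ext w
        have h2 := hy ⁅z, w⁆ ⟨w, rfl⟩
        rw [LinearMap.zero_apply, ← lie_skew, map_neg, LinearMap.neg_apply,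
          LieModule.traceForm_apply_lie_apply, LieModule.traceForm_comm, h2, neg_zero]
      simpa using this
    have hcomm : Commute (LieAlgebra.ad K L y) (LieAlgebra.ad K L z) := by
      have h3 : ⁅LieAlgebra.ad K L z, LieAlgebra.ad K L y⁆ = 0 := by rw [← LieHom.map_lie, h1, map_zero]
      rw [LieRing.of_associative_ring_bracket, sub_eq_zero] at h3
      exact h3.symm
    exact (LinearMap.isNilpotent_trace_of_isNilpotent (hcomm.isNilpotent_mul_left hz)).eq_zero
  obtain ⟨h, hh⟩ := hmem
  have hh' : toEnd K L M z = toEnd K L M z * toEnd K L M h - toEnd K L M h * toEnd K L M z := by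
    conv_lhs => rw [← hh]
    exact (toEnd K L M).map_lie z h
  refine isNilpotent_of_trace_mul_aeval _ fun p => ?_
  have hc := Algebra.commute_of_mem_adjoin_self
    (Polynomial.aeval_mem_adjoin_singleton (p := p) K (toEnd K L M z))
  have h0 := trace_commutator_mul (Y := toEnd K L M h) hc
  set b := Polynomial.aeval (toEnd K L M z) p
  rw [hh', ← neg_sub, neg_mul, map_neg, h0, neg_zero]

/-- If `L` acts irreducibly, `[L, r]` acts trivially for every solvable ideal `r`. -/
theorem lie_lie_eq_zero_of_irreducible (hirr : ∀ N : LieSubmodule K L M, N = ⊥ ∨ N = ⊤)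
    (r : LieIdeal K L) [LieAlgebra.IsSolvable r] :
    ∀ x ∈ ⁅(⊤ : LieIdeal K L), r⁆, ∀ m : M, ⁅x, m⁆ = 0 := by
  -- Elements of `⁅⊤, I⁆` act so as to commute with `I`, hence nilpotently by the trace criterion,
  -- hence trivially by Engel.
  have step1 : ∀ I : LieIdeal K L, (∀ x ∈ ⁅I, I⁆, ∀ m : M, ⁅x, m⁆ = 0) →
      ∀ x ∈ ⁅(⊤ : LieIdeal K L), I⁆, ∀ m : M, ⁅x, m⁆ = 0 := by
    intro I hI
    refine lie_eq_zero_of_forall_isNilpotent hirr _ fun x hx => ?_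
    refine isNilpotent_toEnd_of_mem_lie hx fun a ha => ?_
    have hxI : x ∈ I := LieSubmodule.lie_le_right _ _ hx
    have := hI ⁅a, x⁆ (LieSubmodule.lie_mem_lie ha hxI)
    refine LinearMap.ext fun m => ?_
    have h1 := this m
    rw [lie_lie, sub_eq_zero] at h1
    exact h1
  -- By `step1` for `⁅I, I⁆`, the elements of `⁅I, I⁆` commute with all of `L` on `M`; the trace
  -- criterion and Engel apply again. This climbs the derived series.
  have step2 : ∀ I : LieIdeal K L, (∀ x ∈ ⁅⁅I, I⁆, ⁅I, I⁆⁆, ∀ m : M, ⁅x, m⁆ = 0) →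
      ∀ x ∈ ⁅I, I⁆, ∀ m : M, ⁅x, m⁆ = 0 := by
    intro I hI
    have h1 := step1 ⁅I, I⁆ hI
    refine lie_eq_zero_of_forall_isNilpotent hirr _ fun x hx => ?_
    refine isNilpotent_toEnd_of_mem_lie hx fun a _ => ?_
    refine LinearMap.ext fun m => ?_
    have h2 := h1 ⁅a, x⁆ (LieSubmodule.lie_mem_lie (LieSubmodule.mem_top a) hx) m
    rw [lie_lie, sub_eq_zero] at h2
    exact h2
  apply step1
  obtain ⟨k, hk⟩ := LieAlgebra.IsSolvable.solvable K r
  rw [LieIdeal.derivedSeries_eq_bot_iff] at hk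
  -- The index `k + 1` makes the descent end at `⁅r, r⁆`, the input of `step1`.
  have hk' : ∀ x ∈ LieAlgebra.derivedSeriesOfIdeal K L (k + 1) r, ∀ m : M, ⁅x, m⁆ = 0 := by
    intro x hx m
    have := LieAlgebra.derivedSeriesOfIdeal_succ_le r k hx
    rw [hk, LieSubmodule.mem_bot] at this
    rw [this, zero_lie]
  clear hk
  induction k with
  | zero => exact hk'
  | succ k ih =>
    apply ih
    rw [LieAlgebra.derivedSeriesOfIdeal_succ, LieAlgebra.derivedSeriesOfIdeal_succ] at hk'
    rw [LieAlgebra.derivedSeriesOfIdeal_succ]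
    exact step2 _ hk'

/-- Schur's argument: `⁅⊤, r⁆` acts trivially, so the kernel of `x` is a submodule, and it cannot be
0 for a nilpotent action on a nonzero module. -/
theorem lie_eq_zero_of_irreducible_of_isNilpotent
    (hirr : ∀ N : LieSubmodule K L M, N = ⊥ ∨ N = ⊤)
    (r : LieIdeal K L) [LieAlgebra.IsSolvable r] {x : L} (hx : x ∈ r)
    (hn : IsNilpotent (toEnd K L M x)) (m : M) : ⁅x, m⁆ = 0 := by
  rcases subsingleton_or_nontrivial M with hM | hM
  · exact Subsingleton.elim _ _
  have h := lie_lie_eq_zero_of_irreducible hirr r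
  let N : LieSubmodule K L M :=
    { LinearMap.ker (toEnd K L M x) with
      lie_mem := fun {y m} hm => by
        have hm' : ⁅x, m⁆ = 0 := hm
        change ⁅x, ⁅y, m⁆⁆ = 0
        have := h ⁅y, x⁆ (LieSubmodule.lie_mem_lie (LieSubmodule.mem_top y) hx) m
        rw [lie_lie, hm', lie_zero, zero_sub, neg_eq_zero] at this
        exact this }
  rcases hirr N with h0 | h0
  · exfalso
    have hinj : Function.Injective (toEnd K L M x) := by
      rw [← LinearMap.ker_eq_bot, eq_bot_iff]
      intro m hm
      have : m ∈ N := hm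
      rw [h0] at this
      simpa using this
    obtain ⟨k, hk⟩ := hn
    obtain ⟨m, hm⟩ := exists_ne (0 : M)
    apply hm
    have : Function.Injective ((toEnd K L M x) ^ k) := by
      rw [Module.End.coe_pow]; exact hinj.iterate k
    apply this
    rw [hk]; rfl
  · have : m ∈ N := by rw [h0]; exact LieSubmodule.mem_top m
    exact this

/-- For a solvable ideal `r`, the elements of `r` acting nilpotently on `M` form an ideal
containing `[L, r]`. -/
theorem exists_nilpotent_ideal (r : LieIdeal K L) [LieAlgebra.IsSolvable r] :
    ∃ n : LieIdeal K L, n ≤ r ∧ ⁅(⊤ : LieIdeal K L), r⁆ ≤ n ∧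
      ∀ x ∈ r, (x ∈ n ↔ IsNilpotent (toEnd K L M x)) := by
  -- Induction along a composition series: an element of `r` acts nilpotently on `M` exactly when it
  -- kills every composition factor, and that condition cuts out an ideal.
  have key : ∀ N : LieSubmodule K L M, ∃ n : LieIdeal K L, n ≤ r ∧ ⁅(⊤ : LieIdeal K L), r⁆ ≤ n ∧
      (∀ x ∈ r, IsNilpotent (toEnd K L M x) → x ∈ n) ∧
      ∀ x ∈ n, ∃ k, ∀ m ∈ N, ((toEnd K L M x) ^ k) m = 0 := by
    intro N
    have : WellFoundedLT (LieSubmodule K L M) := LieSubmodule.wellFoundedLT_of_isArtinian K L M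
    have : WellFoundedGT (LieSubmodule K L M) := LieSubmodule.wellFoundedGT_of_noetherian K L M
    induction N using WellFoundedLT.induction with
    | ind N ih =>
    by_cases hbot : N = ⊥
    · refine ⟨r, le_rfl, LieSubmodule.lie_le_right _ _, fun x hx _ => hx, fun x _ => ⟨0, ?_⟩⟩
      intro m hm
      rw [hbot, LieSubmodule.mem_bot] at hm
      simp [hm]
    obtain ⟨N', hN', hcov⟩ : ∃ N' < N, ∀ N'', N' ≤ N'' → N'' ≤ N → N'' = N' ∨ N'' = N := by
      obtain ⟨N', hN', hmax⟩ := (wellFounded_gt (α := LieSubmodule K L M)).has_min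
        {N' | N' < N} ⟨⊥, bot_lt_iff_ne_bot.mpr hbot⟩
      refine ⟨N', hN', fun N'' h1 h2 => ?_⟩
      rcases h2.lt_or_eq with h | h
      · left
        by_contra hne
        exact hmax N'' h (lt_of_le_of_ne h1 (Ne.symm hne))
      · exact Or.inr h
    obtain ⟨n, hn1, hn2, hn3, hn4⟩ := ih N' hN'
    -- the irreducible quotient `N / N'`
    let P : LieSubmodule K L N := N'.comap N.incl
    have : FiniteDimensional K (N ⧸ P) :=
      Module.Finite.of_surjective (LieSubmodule.Quotient.mk' P : N →ₗ[K] N ⧸ P)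
        (LieSubmodule.Quotient.surjective_mk' P)
    have hirr : ∀ Q : LieSubmodule K L (N ⧸ P), Q = ⊥ ∨ Q = ⊤ := by
      intro Q
      let Q' : LieSubmodule K L N := Q.comap (LieSubmodule.Quotient.mk' P)
      have hQ' : ∀ m : N, m ∈ Q' ↔ LieSubmodule.Quotient.mk' P m ∈ Q := fun m => Iff.rfl
      rcases hcov (Q'.map N.incl) (by
          intro m hm
          refine (LieSubmodule.mem_map _).mpr ⟨⟨m, hN'.le hm⟩, ?_, rfl⟩
          rw [hQ']
          have : LieSubmodule.Quotient.mk' P ⟨m, hN'.le hm⟩ = 0 :=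
            (LieSubmodule.Quotient.mk_eq_zero (N := P)).mpr hm
          rw [this]; exact Q.zero_mem) (by
          intro m hm
          obtain ⟨m, -, rfl⟩ := (LieSubmodule.mem_map _).mp hm
          exact m.2) with h | h
      · left
        rw [eq_bot_iff]
        intro q hq
        obtain ⟨m, rfl⟩ := LieSubmodule.Quotient.surjective_mk' P q
        have : (m : M) ∈ N' := by
          rw [← h]; exact LieSubmodule.mem_map_of_mem (f := N.incl) ((hQ' m).mpr hq)
        rw [LieSubmodule.mem_bot]
        exact (LieSubmodule.Quotient.mk_eq_zero (N := P)).mpr this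
      · right
        rw [eq_top_iff]
        intro q _
        obtain ⟨m, rfl⟩ := LieSubmodule.Quotient.surjective_mk' P q
        have : (m : M) ∈ Q'.map N.incl := by rw [h]; exact m.2
        obtain ⟨m', hm', heq⟩ := (LieSubmodule.mem_map _).mp this
        have : m' = m := Subtype.ext heq
        rw [← hQ', ← this]; exact hm'
    -- The annihilator of the simple factor `N / N'`; the required ideal for `N` is its intersection
    -- with the one for `N'`.
    let z : LieIdeal K L :=
      { carrier := {x | ∀ q : N ⧸ P, ⁅x, q⁆ = 0}
        zero_mem' := fun q => zero_lie q
        add_mem' := fun h h' q => by rw [add_lie, h q, h' q, add_zero]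
        smul_mem' := fun c x h q => by rw [smul_lie, h q, smul_zero]
        lie_mem := fun {y x} h q => by rw [lie_lie, h, h, lie_zero, sub_zero] }
    have hzN : ∀ x ∈ z, ∀ m ∈ N, ⁅x, m⁆ ∈ N' := by
      intro x hx m hm
      have h1 : ⁅x, LieSubmodule.Quotient.mk' P ⟨m, hm⟩⁆ = 0 := hx _
      rw [← LieModuleHom.map_lie] at h1
      exact (LieSubmodule.Quotient.mk_eq_zero (N := P)).mp h1
    have hpow : ∀ (x : L) (k : ℕ) (m : N), (((toEnd K L (N ⧸ P) x) ^ k)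
        (LieSubmodule.Quotient.mk' P m)) =
        LieSubmodule.Quotient.mk' P (((toEnd K L N x) ^ k) m) ∧
        ((((toEnd K L N x) ^ k) m : N) : M) = ((toEnd K L M x) ^ k) m := by
      intro x k
      induction k with
      | zero => intro m; exact ⟨rfl, rfl⟩
      | succ k ih =>
        intro m
        rw [pow_succ', pow_succ', pow_succ', Module.End.mul_apply, Module.End.mul_apply,
          Module.End.mul_apply, (ih m).1, ← (ih m).2]
        exact ⟨rfl, rfl⟩
    refine ⟨n ⊓ z, inf_le_left.trans hn1, le_inf hn2 ?_, ?_, ?_⟩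
    · exact fun x hx => lie_lie_eq_zero_of_irreducible hirr r x hx
    · rintro x hx ⟨k, hk⟩
      refine ⟨hn3 x hx ⟨k, hk⟩, fun q => ?_⟩
      refine lie_eq_zero_of_irreducible_of_isNilpotent hirr r hx ⟨k, ?_⟩ q
      refine LinearMap.ext fun q => ?_
      obtain ⟨m, rfl⟩ := LieSubmodule.Quotient.surjective_mk' P q
      rw [(hpow x k m).1]
      have : ((toEnd K L N x) ^ k) m = 0 := Subtype.ext (by rw [(hpow x k m).2, hk]; rfl)
      rw [this, map_zero]; rfl
    · rintro x ⟨hx, hxz⟩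
      obtain ⟨k, hk⟩ := hn4 x hx
      refine ⟨k + 1, fun m hm => ?_⟩
      rw [pow_succ, Module.End.mul_apply]
      exact hk _ (hzN x hxz m hm)
  obtain ⟨n, h1, h2, h3, h4⟩ := key ⊤
  refine ⟨n, h1, h2, fun x hx => ⟨fun hn => ?_, h3 x hx⟩⟩
  obtain ⟨k, hk⟩ := h4 x hn
  exact ⟨k, LinearMap.ext fun m => hk m (LieSubmodule.mem_top m)⟩

end Nilpotency

end GradedLie

/-! ### The ideal of `ad`-nilpotent radical elements, and the Killing form. -/

namespace GradedLie

open LieModule LieAlgebra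

/-- `ad (D z)` is the commutator of `D` and `ad z`; the rest is cyclicity of the trace. -/
theorem killingForm_derivation {K L : Type*} [Field K] [LieRing L] [LieAlgebra K L]
    (D : LieDerivation K L L) (x y : L) :
    killingForm K L (D x) y = - killingForm K L x (D y) := by
  have had : ∀ z, ad K L (D z) = (D : L →ₗ[K] L) * ad K L z - ad K L z * (D : L →ₗ[K] L) := by
    intro z
    ext w
    simp
  rw [LieModule.traceForm_apply_apply, LieModule.traceForm_apply_apply]
  change LinearMap.trace K L (ad K L (D x) * ad K L y) = -LinearMap.trace K L (ad K L x * ad K L (D y))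
  rw [had, had, sub_mul, mul_sub, map_sub, map_sub, mul_assoc, LinearMap.trace_mul_comm, mul_assoc,
    mul_assoc]
  abel

section AdNilIdeal

variable (K L : Type*) [Field K] [CharZero K] [LieRing L] [LieAlgebra K L] [FiniteDimensional K L]

/-- The ideal of `ad`-nilpotent elements of the radical. -/
noncomputable def adNilIdeal : LieIdeal K L :=
  (exists_nilpotent_ideal (M := L) (radical K L)).choose

theorem adNilIdeal_le_radical : adNilIdeal K L ≤ radical K L :=
  (exists_nilpotent_ideal (M := L) (radical K L)).choose_spec.1

theorem lie_top_radical_le_adNilIdeal : ⁅(⊤ : LieIdeal K L), radical K L⁆ ≤ adNilIdeal K L :=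
  (exists_nilpotent_ideal (M := L) (radical K L)).choose_spec.2.1

variable {K L}

theorem mem_adNilIdeal_iff {x : L} (hx : x ∈ radical K L) :
    x ∈ adNilIdeal K L ↔ IsNilpotent (ad K L x) :=
  (exists_nilpotent_ideal (M := L) (radical K L)).choose_spec.2.2 x hx

theorem isNilpotent_ad_of_mem_adNilIdeal {x : L} (hx : x ∈ adNilIdeal K L) :
    IsNilpotent (ad K L x) :=
  (mem_adNilIdeal_iff (adNilIdeal_le_radical K L hx)).mp hx

theorem lie_mem_adNilIdeal {x : L} (y : L) (hx : x ∈ radical K L) : ⁅y, x⁆ ∈ adNilIdeal K L :=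
  lie_top_radical_le_adNilIdeal K L (LieSubmodule.lie_mem_lie (LieSubmodule.mem_top y) hx)

variable (K L)

theorem exists_lcs_adNilIdeal_eq_bot : ∃ k, (adNilIdeal K L).lcs L k = ⊥ := by
  have h : LieModule.IsNilpotent (adNilIdeal K L) L :=
    (LieModule.isNilpotent_iff_forall' (R := K)).mpr fun x => isNilpotent_ad_of_mem_adNilIdeal x.2
  obtain ⟨k, hk⟩ := (LieModule.isNilpotent_iff K (adNilIdeal K L) L).mp h
  refine ⟨k, ?_⟩
  rw [← LieSubmodule.toSubmodule_eq_bot, LieIdeal.coe_lcs_eq, hk, LieSubmodule.bot_toSubmodule]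

/-- This inclusion is how the reductive type hypothesis enters: the degree 0 part of `adNilIdeal` is
then zero. -/
theorem adNilIdeal_le_nilradical : adNilIdeal K L ≤ nilradical K L := by
  refine le_sSup ?_
  change LieRing.IsNilpotent (adNilIdeal K L)
  rw [LieAlgebra.isNilpotent_iff_forall (R := K)]
  intro x
  exact LieSubalgebra.isNilpotent_ad_of_isNilpotent_ad (adNilIdeal K L : LieSubalgebra K L)
    (x := x) (isNilpotent_ad_of_mem_adNilIdeal x.2)

variable {K L}

/-- `ad x * ad y` moves each term of the series `lcs L j` into the next, so it is nilpotent. -/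
theorem killingForm_eq_zero_of_mem_adNilIdeal {x : L} (hx : x ∈ adNilIdeal K L) (y : L) :
    killingForm K L x y = 0 := by
  refine (LinearMap.isNilpotent_trace_of_isNilpotent ?_).eq_zero
  obtain ⟨k, hk⟩ := exists_lcs_adNilIdeal_eq_bot K L
  refine ⟨k, LinearMap.ext fun z => ?_⟩
  have : ∀ j, ((ad K L x * ad K L y) ^ j) z ∈ (adNilIdeal K L).lcs L j := by
    intro j
    induction j with
    | zero => exact LieSubmodule.mem_top z
    | succ j ih =>
      rw [pow_succ', Module.End.mul_apply, LieIdeal.lcs_succ]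
      exact LieSubmodule.lie_mem_lie hx (LieSubmodule.lie_mem _ ih)
  have h := this k
  rw [hk, LieSubmodule.mem_bot] at h
  exact h

variable (K L) in
/-- The radical is the orthogonal of the derived algebra for the Killing form. -/
theorem radical_eq_killingCompl :
    radical K L = LieIdeal.killingCompl K L ⁅(⊤ : LieIdeal K L), (⊤ : LieIdeal K L)⁆ := by
  refine le_antisymm ?_ ?_
  · intro x hx
    rw [LieIdeal.mem_killingCompl]
    intro d hd
    rw [← LieSubmodule.mem_toSubmodule, LieSubmodule.lieIdeal_oper_eq_linear_span'] at hd
    induction hd using Submodule.span_induction with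
    | mem d hd =>
      obtain ⟨y, -, z, -, rfl⟩ := hd
      rw [LieModule.traceForm_apply_lie_apply, LieModule.traceForm_comm]
      exact killingForm_eq_zero_of_mem_adNilIdeal (lie_mem_adNilIdeal z hx) y
    | zero => simp
    | add a b _ _ ha hb => rw [map_add, LinearMap.add_apply, ha, hb, add_zero]
    | smul c a _ ha => rw [map_smul, LinearMap.smul_apply, ha, smul_zero]
  -- The reverse inclusion is Cartan's solvability criterion.
  · rw [← LieIdeal.solvable_iff_le_radical]
    refine LieIdeal.isSolvable_of_killingForm_apply_lie_eq_zero _ fun x hx y hy => ?_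
    rw [LieIdeal.mem_killingCompl] at hx
    rw [LieModule.traceForm_comm]
    exact hx y (LieSubmodule.mono_lie le_top le_top hy)

/-- A derivation preserves the derived algebra and is skew for the Killing form, so it preserves the
orthogonal. -/
theorem derivation_mem_radical (D : LieDerivation K L L) {x : L} (hx : x ∈ radical K L) :
    D x ∈ radical K L := by
  rw [radical_eq_killingCompl, LieIdeal.mem_killingCompl] at hx ⊢
  intro d hd
  have hDd : D d ∈ ⁅(⊤ : LieIdeal K L), (⊤ : LieIdeal K L)⁆ := by
    rw [← LieSubmodule.mem_toSubmodule, LieSubmodule.lieIdeal_oper_eq_linear_span'] at hd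
    induction hd using Submodule.span_induction with
    | mem d hd =>
      obtain ⟨y, -, z, -, rfl⟩ := hd
      rw [LieDerivation.apply_lie_eq_add]
      exact Submodule.add_mem (LieSubmodule.toSubmodule _)
        (LieSubmodule.lie_mem_lie (LieSubmodule.mem_top _) (LieSubmodule.mem_top _))
        (LieSubmodule.lie_mem_lie (LieSubmodule.mem_top _) (LieSubmodule.mem_top _))
    | zero => rw [map_zero]; exact LieSubmodule.zero_mem _
    | add a b _ _ ha hb => rw [map_add]; exact Submodule.add_mem (LieSubmodule.toSubmodule _) ha hb
    | smul c a _ ha => rw [map_smul]; exact Submodule.smul_mem (LieSubmodule.toSubmodule _) _ ha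
  have := killingForm_derivation D d x
  rw [hx _ hDd] at this
  exact neg_eq_zero.mp this.symm

end AdNilIdeal

end GradedLie

namespace GradedLie

open LieModule LieAlgebra

/-! ### The key step of Levi's theorem, compatible with a derivation. -/

section Levi

variable {K L : Type*} [Field K] [CharZero K] [LieRing L] [LieAlgebra K L] [FiniteDimensional K L]

/-- If the radical part `a` is nonzero, there is a proper subalgebra supplementing `a`, stable
under a given semisimple derivation. -/
theorem exists_proper_supplement (D : LieDerivation K L L)
    (hD : Module.End.IsSemisimple (D : L →ₗ[K] L)) (a : LieIdeal K L) (haD : ∀ x ∈ a, D x ∈ a)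
    [IsKilling K (L ⧸ a)] (hab : ⁅a, a⁆ ≠ a) :
    ∃ s : LieSubalgebra K L, s ≠ ⊤ ∧ (∀ x ∈ s, D x ∈ s) ∧ s.toSubmodule ⊔ a.toSubmodule = ⊤ := by
  set b : LieIdeal K L := ⁅a, a⁆ with hb
  have hba : b ≤ a := LieSubmodule.lie_le_right _ _
  have hbD : ∀ x ∈ b, D x ∈ b := by
    intro x hx
    rw [← LieSubmodule.mem_toSubmodule, hb, LieSubmodule.lieIdeal_oper_eq_linear_span'] at hx
    induction hx using Submodule.span_induction with
    | mem d hd =>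
      obtain ⟨y, hy, z, hz, rfl⟩ := hd
      rw [LieDerivation.apply_lie_eq_add]
      exact Submodule.add_mem b.toSubmodule
        (LieSubmodule.lie_mem_lie hy (haD _ hz)) (LieSubmodule.lie_mem_lie (haD _ hy) hz)
    | zero => rw [map_zero]; exact LieSubmodule.zero_mem _
    | add a b _ _ ha hb => rw [map_add]; exact Submodule.add_mem (LieSubmodule.toSubmodule _) ha hb
    | smul c a _ ha => rw [map_smul]; exact Submodule.smul_mem (LieSubmodule.toSubmodule _) _ ha
  let q : L →ₗ⁅K, L⁆ L ⧸ b := LieSubmodule.Quotient.mk' b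
  have hq : Function.Surjective q := LieSubmodule.Quotient.surjective_mk' b
  have hq0 : ∀ {x}, q x = 0 ↔ x ∈ b := LieSubmodule.Quotient.mk_eq_zero (N := b)
  have : FiniteDimensional K (L ⧸ b) := Module.Finite.of_surjective (q : L →ₗ[K] L ⧸ b) hq
  let D' : Module.End K (L ⧸ b) := b.toSubmodule.mapQ b.toSubmodule (D : L →ₗ[K] L) hbD
  have hD' : ∀ x, q (D x) = D' (q x) := fun x => rfl
  have hD'ss : D'.IsSemisimple := isSemisimple_of_surjective (φ := (q : L →ₗ[K] L ⧸ b)) hq hD' hD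
  let E : Module.End K (L →ₗ[K] L ⧸ b) := homAction (D : L →ₗ[K] L) D'
  have hE : E.IsSemisimple := isSemisimple_homAction hD hD'ss
  have hEapp : ∀ φ x, E φ x = D' (φ x) - φ (D x) := fun φ x => rfl
  have hD'lie : ∀ (x : L) (v : L ⧸ b), D' ⁅x, v⁆ = ⁅D x, v⁆ + ⁅x, D' v⁆ := by
    intro x v
    obtain ⟨v, rfl⟩ := hq v
    rw [← LieModuleHom.map_lie, ← hD', LieDerivation.apply_lie_eq_add, map_add,
      LieModuleHom.map_lie, LieModuleHom.map_lie, hD', add_comm]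
  have hElie : ∀ (x : L) (φ : L →ₗ[K] L ⧸ b), E ⁅x, φ⁆ = ⁅D x, φ⁆ + ⁅x, E φ⁆ := by
    intro x φ
    ext y
    simp only [hEapp, LinearMap.add_apply, LieHom.lie_apply, map_sub, hD'lie,
      LieDerivation.apply_lie_eq_add, map_add, lie_sub]
    abel
  have hqab : ∀ x ∈ a, ∀ y ∈ a, ⁅x, q y⁆ = 0 := by
    intro x hx y hy
    rw [← LieModuleHom.map_lie, hq0]
    exact LieSubmodule.lie_mem_lie hx hy
  let aq : LieSubmodule K L (L ⧸ b) := LieSubmodule.map q a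
  have haq : ∀ v ∈ aq, ∃ y ∈ a, q y = v := fun v hv => (LieSubmodule.mem_map _).mp hv
  have hlie0 : ∀ (x : L) (φ : L →ₗ[K] L ⧸ b) (c : K), (∀ y ∈ a, φ y = c • q y) →
      ∀ y ∈ a, ⁅x, φ⁆ y = 0 := by
    intro x φ c h y hy
    rw [LieHom.lie_apply, h y hy, h _ (lie_mem_right K L a x y hy), LieModuleHom.map_lie, lie_smul,
      sub_self]
  -- Inside `Hom (L, L / b)`: `P` consists of the maps into `a / b` that are scalar on `a`, `Q` of
  -- the maps that vanish on `a`, `R` of the inner maps `y ↦ q ⁅y, z⁆` with `z ∈ a`. `L` sends `P`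
  -- into `Q`, and `a` sends `P` into `R`, so `P` modulo `R` is a module over the Killing algebra `L
  -- / a`.
  let P : LieSubmodule K L (L →ₗ[K] L ⧸ b) :=
    { carrier := {φ | (∀ x, φ x ∈ aq) ∧ ∃ c : K, ∀ y ∈ a, φ y = c • q y}
      zero_mem' := ⟨fun _ => aq.zero_mem, 0, fun _ _ => by simp⟩
      add_mem' := by
        rintro φ ψ ⟨h, c, hc⟩ ⟨h', c', hc'⟩
        exact ⟨fun x => aq.add_mem (h x) (h' x), c + c', fun y hy => by
          rw [LinearMap.add_apply, hc y hy, hc' y hy, add_smul]⟩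
      smul_mem' := by
        rintro t φ ⟨h, c, hc⟩
        exact ⟨fun x => aq.smul_mem t (h x), t * c, fun y hy => by
          rw [LinearMap.smul_apply, hc y hy, mul_smul]⟩
      lie_mem := by
        rintro x φ ⟨h, c, hc⟩
        exact ⟨fun y => aq.sub_mem (aq.lie_mem (h y)) (h _), 0, fun y hy => by
          rw [hlie0 x φ c hc y hy, zero_smul]⟩ }
  let Q : LieSubmodule K L (L →ₗ[K] L ⧸ b) :=
    { carrier := {φ | ∀ y ∈ a, φ y = 0}
      zero_mem' := fun _ _ => rfl
      add_mem' := fun h h' y hy => by rw [LinearMap.add_apply, h y hy, h' y hy, add_zero]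
      smul_mem' := fun t φ h y hy => by rw [LinearMap.smul_apply, h y hy, smul_zero]
      lie_mem := fun {x φ} h => hlie0 x φ 0 (fun y hy => by rw [h y hy, zero_smul]) }
  let R : LieSubmodule K L (L →ₗ[K] L ⧸ b) :=
    { carrier := {φ | ∃ z ∈ a, ∀ y, φ y = q ⁅y, z⁆}
      zero_mem' := ⟨0, a.zero_mem, fun _ => by simp⟩
      add_mem' := by
        rintro φ ψ ⟨z, hz, h⟩ ⟨z', hz', h'⟩
        exact ⟨z + z', a.add_mem hz hz', fun y => by
          rw [LinearMap.add_apply, h, h', lie_add, map_add]⟩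
      smul_mem' := by
        rintro t φ ⟨z, hz, h⟩
        exact ⟨t • z, a.smul_mem t hz, fun y => by rw [LinearMap.smul_apply, h, lie_smul, map_smul]⟩
      lie_mem := by
        rintro x φ ⟨z, hz, h⟩
        refine ⟨⁅x, z⁆, lie_mem_right K L a x z hz, fun y => ?_⟩
        rw [LieHom.lie_apply, h, h, ← LieModuleHom.map_lie, ← map_sub, leibniz_lie x y z]
        congr 1
        abel }
  have haR : ∀ x ∈ a, ∀ φ ∈ P, ∀ c : K, (∀ y ∈ a, φ y = c • q y) → ∀ y, ⁅x, φ⁆ y = c • q ⁅y, x⁆ := by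
    intro x hx φ hφ c hc y
    obtain ⟨z, hz, hzy⟩ := haq _ (hφ.1 y)
    rw [LieHom.lie_apply, ← hzy, hqab x hx z hz, hc _ (lie_mem_left K L a x y hx), ← lie_skew,
      map_neg, smul_neg, sub_neg_eq_add, zero_add]
  have haPR : ∀ x ∈ a, ∀ φ ∈ P, ⁅x, φ⁆ ∈ R := by
    rintro x hx φ hφ
    obtain ⟨c, hc⟩ := hφ.2
    exact ⟨c • x, a.smul_mem c hx, fun y => by rw [haR x hx φ hφ c hc, lie_smul, map_smul]⟩
  obtain ⟨p, hp⟩ := Submodule.exists_isCompl a.toSubmodule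
  let φ₀ : L →ₗ[K] L ⧸ b := (q : L →ₗ[K] L ⧸ b) ∘ₗ a.toSubmodule.subtype ∘ₗ
    Submodule.projectionOnto _ _ hp
  have hφ₀P : φ₀ ∈ P := by
    refine ⟨fun x => LieSubmodule.mem_map_of_mem (Submodule.projectionOnto _ _ hp x).2,
      1, fun y hy => ?_⟩
    rw [one_smul]
    exact congrArg q (congrArg Subtype.val (Submodule.projectionOnto_apply_left hp ⟨y, hy⟩))
  have hφ₀ : ∀ y ∈ a, φ₀ y = q y := fun y hy =>
    congrArg q (congrArg Subtype.val (Submodule.projectionOnto_apply_left hp ⟨y, hy⟩))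
  -- Correcting the projection `φ₀` by an element of `Q` keeps it equal to `q` on `a` and makes it
  -- invariant modulo `R`.
  obtain ⟨⟨ψ, hψP⟩, hψQ, hψ⟩ := exists_sub_lie_mem (M := P) a (R.comap P.incl) (Q.comap P.incl)
    (fun x hx φ => haPR x hx φ φ.2) ⟨φ₀, hφ₀P⟩
    (fun x => hlie0 x φ₀ 1 fun y hy => by rw [hφ₀ y hy, one_smul])
  let φ₁ := φ₀ - ψ
  have hφ₁P : φ₁ ∈ P := P.sub_mem hφ₀P hψP
  have hφ₁ : ∀ y ∈ a, φ₁ y = q y := fun y hy => by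
    change φ₀ y - ψ y = q y
    rw [hφ₀ y hy, show ψ y = 0 from hψQ y hy, sub_zero]
  have hφ₁R : ∀ x : L, ⁅x, φ₁⁆ ∈ R := hψ
  -- averaging over the derivation
  let Wc : Submodule K (L →ₗ[K] L ⧸ b) :=
    { carrier := {φ | φ ∈ P ∧ ∀ x : L, ⁅x, φ⁆ ∈ R}
      zero_mem' := ⟨P.zero_mem, fun x => by rw [lie_zero]; exact R.zero_mem⟩
      add_mem' := fun h h' => ⟨P.add_mem h.1 h'.1, fun x => by
        rw [lie_add]; exact R.add_mem (h.2 x) (h'.2 x)⟩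
      smul_mem' := fun c φ h => ⟨P.smul_mem c h.1, fun x => by
        rw [lie_smul]; exact R.smul_mem c (h.2 x)⟩ }
  have hE0 : ∀ φ ∈ P, ∀ y ∈ a, E φ y = 0 := by
    rintro φ ⟨-, c, hc⟩ y hy
    rw [hEapp, hc y hy, hc _ (haD y hy), hD', map_smul, sub_self]
  have hWcE : ∀ φ ∈ Wc, E φ ∈ Wc := by
    rintro φ ⟨hφP, hφR⟩
    refine ⟨⟨fun x => ?_, 0, fun y hy => by rw [hE0 φ hφP y hy, zero_smul]⟩, fun x => ?_⟩
    · rw [hEapp]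
      refine aq.sub_mem ?_ (hφP.1 _)
      obtain ⟨z, hz, hzx⟩ := haq _ (hφP.1 x)
      rw [← hzx, ← hD']
      exact LieSubmodule.mem_map_of_mem (haD z hz)
    · have h1 : ⁅x, E φ⁆ = E ⁅x, φ⁆ - ⁅D x, φ⁆ := by rw [hElie]; abel
      rw [h1]
      refine R.sub_mem ?_ (hφR _)
      obtain ⟨z, hz, h⟩ := hφR x
      refine ⟨D z, haD z hz, fun y => ?_⟩
      rw [hEapp, h, h, ← hD', ← map_sub, LieDerivation.apply_lie_eq_add]
      congr 1
      abel
  -- `E` vanishes on `a` for every map in `P`, so discarding the image of `E` does not change the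
  -- restriction to `a`.
  obtain ⟨φ, hφW, ψ', hψ'W, hEφ, hsum⟩ := exists_ker_add_apply hE IsNilpotent.zero
    (Commute.zero_right E) hWcE (fun v _ => Wc.zero_mem) (show φ₁ ∈ Wc from ⟨hφ₁P, hφ₁R⟩)
  have hφ : ∀ y ∈ a, φ y = q y := by
    intro y hy
    have h := LinearMap.congr_fun hsum y
    rw [hφ₁ y hy] at h
    simp only [LinearMap.add_apply, LinearMap.zero_apply, add_zero] at h
    rw [hE0 ψ' hψ'W.1 y hy, add_zero] at h
    exact h.symm
  have haφ : ∀ x ∈ a, ∀ y, ⁅x, φ⁆ y = q ⁅y, x⁆ := by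
    intro x hx y
    rw [haR x hx φ hφW.1 1 (fun y hy => by rw [hφ y hy, one_smul]) y, one_smul]
  -- The stabilizer of `φ` supplements `a`: each `⁅x, φ⁆` lies in `R`, and every element of `R` is
  -- `⁅z, φ⁆` for some `z ∈ a`.
  let s : LieSubalgebra K L :=
    { carrier := {x | ⁅x, φ⁆ = 0}
      zero_mem' := zero_lie φ
      add_mem' := fun {x y} hx hy => by
        change ⁅x + y, φ⁆ = 0
        rw [add_lie, show ⁅x, φ⁆ = 0 from hx, show ⁅y, φ⁆ = 0 from hy, add_zero]
      smul_mem' := fun c x hx => by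
        change ⁅c • x, φ⁆ = 0
        rw [smul_lie, show ⁅x, φ⁆ = 0 from hx, smul_zero]
      lie_mem' := fun {x y} hx hy => by
        change ⁅⁅x, y⁆, φ⁆ = 0
        rw [lie_lie, show ⁅x, φ⁆ = 0 from hx, show ⁅y, φ⁆ = 0 from hy, lie_zero, lie_zero,
          sub_self] }
  have hs : ∀ x, x ∈ s ↔ ⁅x, φ⁆ = 0 := fun x => Iff.rfl
  -- If `φ` is invariant under all of `L`, then it kills brackets and its kernel serves instead.
  -- That kernel is proper because `φ = q` on `a` and `⁅a, a⁆ ≠ a`.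
  by_cases hst : s = ⊤
  · have hall : ∀ x : L, ⁅x, φ⁆ = 0 := fun x => by rw [← hs, hst]; trivial
    have hker : ∀ x y : L, φ ⁅x, y⁆ = 0 := by
      intro x y
      have h1 := LinearMap.congr_fun (hall x) y
      rw [LieHom.lie_apply, LinearMap.zero_apply, sub_eq_zero] at h1
      obtain ⟨z, hz, hzy⟩ := haq _ (hφW.1.1 y)
      rw [← h1, ← hzy, ← LieModuleHom.map_lie, ← haφ z hz x, hall]
      rfl
    refine ⟨{ LinearMap.ker φ with lie_mem' := fun {x y} _ _ => hker x y }, ?_, ?_, ?_⟩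
    · intro htop
      apply hab
      refine le_antisymm hba fun x hx => ?_
      have h1 : x ∈ (⊤ : LieSubalgebra K L) := trivial
      rw [← htop] at h1
      have h2 : φ x = 0 := h1
      rw [hφ x hx] at h2
      exact hq0.mp h2
    · intro x hx
      have h1 := LinearMap.congr_fun hEφ x
      rw [hEapp, show φ x = 0 from hx, map_zero, zero_sub, LinearMap.zero_apply, neg_eq_zero] at h1
      exact h1
    · rw [eq_top_iff]
      intro x _
      obtain ⟨z, hz, hzx⟩ := haq _ (hφW.1.1 x)
      refine Submodule.mem_sup.mpr ⟨x - z, ?_, z, hz, by abel⟩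
      change φ (x - z) = 0
      rw [map_sub, hφ z hz, hzx, sub_self]
  · refine ⟨s, hst, fun x hx => ?_, ?_⟩
    · have h1 := hElie x φ
      rw [(hs x).mp hx, hEφ, lie_zero, map_zero, add_zero] at h1
      exact h1.symm
    · rw [eq_top_iff]
      intro x _
      obtain ⟨z, hz, h⟩ := hφW.2 x
      refine Submodule.mem_sup.mpr ⟨x - z, ?_, z, hz, by abel⟩
      change ⁅x - z, φ⁆ = 0
      rw [sub_lie, sub_eq_zero]
      ext y
      rw [h, haφ z hz]

end Levi

end GradedLie

namespace GradedLie

open LieModule LieAlgebra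

/-! ### Levi's theorem relative to a semisimple derivation. -/

section LeviExistence

variable {K L : Type*} [Field K] [LieRing L] [LieAlgebra K L]

/-- The quotient map of a Lie algebra by an ideal. -/
def quotientLieHom (I : LieIdeal K L) : L →ₗ⁅K⁆ L ⧸ I :=
  { (LieSubmodule.Quotient.mk' I : L →ₗ[K] L ⧸ I) with
    map_lie' := fun {x y} => LieSubmodule.Quotient.mk_bracket I x y }

theorem quotientLieHom_surjective (I : LieIdeal K L) : Function.Surjective (quotientLieHom I) :=
  LieSubmodule.Quotient.surjective_mk' I

theorem quotientLieHom_eq_zero_iff {I : LieIdeal K L} {x : L} :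
    quotientLieHom I x = 0 ↔ x ∈ I :=
  LieSubmodule.Quotient.mk_eq_zero (N := I)

variable [FiniteDimensional K L]

theorem finiteDimensional_quotient (I : LieIdeal K L) : FiniteDimensional K (L ⧸ I) :=
  Module.Finite.of_surjective (quotientLieHom I : L →ₗ[K] L ⧸ I) (quotientLieHom_surjective I)

/-- The preimage of a solvable ideal is an extension of it by the radical, hence solvable, hence
inside the radical. -/
theorem hasTrivialRadical_quotient : HasTrivialRadical K (L ⧸ radical K L) := by
  refine hasTrivialRadical_of_no_solvable_ideals fun I hI => ?_
  set f := quotientLieHom (radical K L)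
  obtain ⟨k, hk⟩ := IsSolvable.solvable K I
  rw [LieIdeal.derivedSeries_eq_bot_iff] at hk
  let J : LieIdeal K L := I.comap f
  have hJ : ∀ j, ∀ x ∈ derivedSeriesOfIdeal K L j J,
      f x ∈ derivedSeriesOfIdeal K (L ⧸ radical K L) j I := by
    intro j
    induction j with
    | zero => exact fun x hx => hx
    | succ j ih =>
      intro x hx
      rw [derivedSeriesOfIdeal_succ] at hx ⊢
      rw [← LieSubmodule.mem_toSubmodule, LieSubmodule.lieIdeal_oper_eq_linear_span'] at hx
      induction hx using Submodule.span_induction with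
      | mem d hd =>
        obtain ⟨y, hy, z, hz, rfl⟩ := hd
        rw [LieHom.map_lie]
        exact LieSubmodule.lie_mem_lie (ih y hy) (ih z hz)
      | zero => rw [map_zero]; exact LieSubmodule.zero_mem _
      | add a b _ _ ha hb =>
        rw [map_add]; exact Submodule.add_mem (LieSubmodule.toSubmodule _) ha hb
      | smul c a _ ha => rw [map_smul]; exact Submodule.smul_mem (LieSubmodule.toSubmodule _) _ ha
  have hJr : derivedSeriesOfIdeal K L k J ≤ radical K L := by
    intro x hx
    have := hJ k x hx
    rw [hk, LieSubmodule.mem_bot] at this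
    exact quotientLieHom_eq_zero_iff.mp this
  obtain ⟨m, hm⟩ := IsSolvable.solvable K (radical K L)
  rw [LieIdeal.derivedSeries_eq_bot_iff] at hm
  have hJs : IsSolvable J := by
    refine IsSolvable.mk (R := K) (k := m + k) ((LieIdeal.derivedSeries_eq_bot_iff J _).mpr ?_)
    rw [derivedSeriesOfIdeal_add, eq_bot_iff, ← hm]
    exact derivedSeriesOfIdeal_mono hJr m
  have hJr' : J ≤ radical K L := (LieIdeal.solvable_iff_le_radical K L J).mp hJs
  rw [eq_bot_iff]
  intro y hy
  obtain ⟨x, rfl⟩ := quotientLieHom_surjective _ y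
  rw [LieSubmodule.mem_bot]
  exact quotientLieHom_eq_zero_iff.mpr (hJr' hy)

variable [CharZero K]

theorem isKilling_quotient_radical : IsKilling K (L ⧸ radical K L) := by
  have := hasTrivialRadical_quotient (K := K) (L := L)
  have := finiteDimensional_quotient (radical K L)
  infer_instance

/-- A subalgebra complementary to the radical has nondegenerate Killing form. -/
theorem isKilling_of_isCompl_radical (s : LieSubalgebra K L)
    (h : IsCompl s.toSubmodule (radical K L).toSubmodule) : IsKilling K s := by
  let f : s →ₗ⁅K⁆ L ⧸ radical K L := (quotientLieHom (radical K L)).comp s.incl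
  have hinj : Function.Injective f := by
    rw [injective_iff_map_eq_zero]
    intro x hx
    have hx' : (x : L) ∈ radical K L := quotientLieHom_eq_zero_iff.mp hx
    exact Subtype.ext (Submodule.disjoint_def.mp h.disjoint x x.2 hx')
  have hsurj : Function.Surjective f := by
    intro y
    obtain ⟨x, rfl⟩ := quotientLieHom_surjective _ y
    have hx : x ∈ s.toSubmodule ⊔ (radical K L).toSubmodule := by
      rw [h.sup_eq_top]; exact Submodule.mem_top
    obtain ⟨u, hu, v, hv, rfl⟩ := Submodule.mem_sup.mp hx
    refine ⟨⟨u, hu⟩, ?_⟩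
    rw [map_add, quotientLieHom_eq_zero_iff.mpr hv, add_zero]
    rfl
  have := isKilling_quotient_radical (K := K) (L := L)
  exact (LieEquiv.ofBijective f ⟨hinj, hsurj⟩).symm.isKilling

/-- **Levi's theorem** relative to a semisimple derivation `D`: every `D`-stable supplement of the
radical contains a `D`-stable complement of the radical. -/
theorem exists_levi (D : LieDerivation K L L) (hD : Module.End.IsSemisimple (D : L →ₗ[K] L))
    (c : LieSubalgebra K L) (hcD : ∀ x ∈ c, D x ∈ c)
    (hc : c.toSubmodule ⊔ (radical K L).toSubmodule = ⊤) :
    ∃ s ≤ c, (∀ x ∈ s, D x ∈ s) ∧ IsCompl s.toSubmodule (radical K L).toSubmodule := by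
  -- As long as `c` meets the radical, the intersection `f.ker` is a nonzero solvable ideal of `c`
  -- with Killing quotient, and `exists_proper_supplement` shrinks `c`.
  induction hn : Module.finrank K c using Nat.strong_induction_on generalizing c with
  | _ n ih =>
  by_cases hdis : Disjoint c.toSubmodule (radical K L).toSubmodule
  · exact ⟨c, le_rfl, hcD, hdis, codisjoint_iff.mpr hc⟩
  let f : c →ₗ⁅K⁆ L ⧸ radical K L := (quotientLieHom (radical K L)).comp c.incl
  have hf : ∀ x : c, x ∈ f.ker ↔ (x : L) ∈ radical K L := fun x => by
    rw [LieHom.mem_ker]; exact quotientLieHom_eq_zero_iff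
  have hsurj : Function.Surjective f := by
    intro y
    obtain ⟨x, rfl⟩ := quotientLieHom_surjective _ y
    have hx : x ∈ c.toSubmodule ⊔ (radical K L).toSubmodule := by
      rw [hc]; exact Submodule.mem_top
    obtain ⟨u, hu, v, hv, rfl⟩ := Submodule.mem_sup.mp hx
    refine ⟨⟨u, hu⟩, ?_⟩
    rw [map_add, quotientLieHom_eq_zero_iff.mpr hv, add_zero]
    rfl
  have := isKilling_quotient_radical (K := K) (L := L)
  have hkill : IsKilling K (c ⧸ f.ker) := by
    have h1 : f.range = ⊤ := f.range_eq_top.mpr hsurj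
    have e1 : (⊤ : LieSubalgebra K (L ⧸ radical K L)) ≃ₗ⁅K⁆ f.range :=
      (LieEquiv.ofEq _ _ (by rw [h1]))
    exact ((LieSubalgebra.topEquiv.symm.trans e1).trans f.quotKerEquivRange.symm).isKilling
  let Dc : LieDerivation K c c :=
    { (D : L →ₗ[K] L).restrict (p := c.toSubmodule) (q := c.toSubmodule) hcD with
      leibniz' := fun x y => Subtype.ext (D.leibniz' x y) }
  have hDc : ∀ x : c, ((Dc x : c) : L) = D x := fun x => rfl
  have hDcss : Module.End.IsSemisimple (Dc : c →ₗ[K] c) := hD.restrict hcD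
  have hsol : IsSolvable f.ker := by
    let g : f.ker →ₗ⁅K⁆ radical K L :=
      { toFun := fun x => ⟨x.1.1, (hf x.1).mp x.2⟩
        map_add' := fun _ _ => rfl
        map_smul' := fun _ _ => rfl
        map_lie' := rfl }
    have hg : Function.Injective g := fun x y h =>
      Subtype.ext (Subtype.ext (congrArg (fun z : radical K L => (z : L)) h))
    exact hg.lieAlgebra_isSolvable
  have hne : f.ker ≠ ⊥ := by
    intro h0
    apply hdis
    rw [Submodule.disjoint_def]
    intro x hx hxr
    have : (⟨x, hx⟩ : c) ∈ f.ker := (hf _).mpr hxr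
    rw [h0, LieSubmodule.mem_bot] at this
    exact congrArg Subtype.val this
  have hne' : ⁅f.ker, f.ker⁆ ≠ f.ker := by
    intro heq
    obtain ⟨k, hk⟩ := IsSolvable.solvable K f.ker
    rw [LieIdeal.derivedSeries_eq_bot_iff] at hk
    have : ∀ k, derivedSeriesOfIdeal K c k f.ker = f.ker := by
      intro k
      induction k with
      | zero => rfl
      | succ k ih => rw [derivedSeriesOfIdeal_succ, ih, heq]
    exact hne ((this k).symm.trans hk)
  obtain ⟨s, hst, hsD, hsup⟩ := exists_proper_supplement Dc hDcss f.ker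
    (fun x hx => (hf _).mpr (derivation_mem_radical D ((hf x).mp hx))) hne'
  let s' : LieSubalgebra K L := s.map c.incl
  have hs' : ∀ x : L, x ∈ s' ↔ ∃ y ∈ s, (y : L) = x := fun x => LieSubalgebra.mem_map ..
  have hs'c : s' ≤ c := by
    intro x hx
    obtain ⟨y, -, rfl⟩ := (hs' x).mp hx
    exact y.2
  have hlt : Module.finrank K s' < n := by
    rw [← hn]
    refine Submodule.finrank_lt_finrank_of_lt (lt_of_le_of_ne hs'c fun heq => hst ?_)
    rw [eq_top_iff]
    intro x _
    have : (x : L) ∈ s'.toSubmodule := by rw [heq]; exact x.2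
    obtain ⟨y, hy, hyx⟩ := (hs' x).mp this
    rwa [← Subtype.ext hyx]
  obtain ⟨t, hts, htD, ht⟩ := ih _ hlt s' (by
      intro x hx
      obtain ⟨y, hy, rfl⟩ := (hs' x).mp hx
      exact (hs' _).mpr ⟨Dc y, hsD y hy, rfl⟩) (by
      rw [eq_top_iff, ← hc]
      refine sup_le (fun x hx => ?_) le_sup_right
      have h1 : (⟨x, hx⟩ : c) ∈ s.toSubmodule ⊔ f.ker.toSubmodule := by
        rw [hsup]; exact Submodule.mem_top
      obtain ⟨u, hu, v, hv, huv⟩ := Submodule.mem_sup.mp h1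
      have h2 : (u : L) + v = x := congrArg Subtype.val huv
      rw [← h2]
      exact Submodule.add_mem_sup ((hs' _).mpr ⟨u, hu, rfl⟩) ((hf v).mp hv)) rfl
  exact ⟨t, hts.trans hs'c, htD, ht⟩

end LeviExistence

end GradedLie

namespace GradedLie

open LieModule LieAlgebra

/-! ### Jordan components inside Killing subalgebras. -/

section JordanInSubalgebra

variable {K L : Type*} [Field K] [LieRing L] [LieAlgebra K L]

theorem coe_toLinearMap_ad (x : L) :
    ((LieDerivation.ad K L x : LieDerivation K L L) : L →ₗ[K] L) = ad K L x := by
  ext; simp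

variable [CharZero K] [FiniteDimensional K L]

/-- The Jordan–Chevalley components of a derivation are derivations. -/
theorem IsJordanChevalley.apply_lie {D : LieDerivation K L L} {S N : Module.End K L}
    (h : IsJordanChevalley (D : L →ₗ[K] L) S N) (x y : L) :
    S ⁅x, y⁆ = ⁅S x, y⁆ + ⁅x, S y⁆ ∧ N ⁅x, y⁆ = ⁅N x, y⁆ + ⁅x, N y⁆ := by
  -- The Leibniz rule says that `ad` intertwines `D` with `homAction D D`, so the Jordan components
  -- are intertwined as well.
  have hφ : ∀ v, (ad K L : L →ₗ[K] Module.End K L) ((D : L →ₗ[K] L) v) =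
      GradedLie.homAction (D : L →ₗ[K] L) (D : L →ₗ[K] L)
        ((ad K L : L →ₗ[K] Module.End K L) v) := by
    intro v
    ext w
    simp
  obtain ⟨h1, h2⟩ := h.intertwine (h.homAction h) hφ x
  have h1' := LinearMap.congr_fun h1 y
  have h2' := LinearMap.congr_fun h2 y
  rw [homAction_apply] at h1' h2'
  exact ⟨sub_eq_iff_eq_add.mp h1'.symm, sub_eq_iff_eq_add.mp h2'.symm⟩

theorem IsJordanChevalley.apply_lie_of_ad {x : L} {S N : Module.End K L}
    (h : IsJordanChevalley (ad K L x) S N) (y z : L) :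
    S ⁅y, z⁆ = ⁅S y, z⁆ + ⁅y, S z⁆ ∧ N ⁅y, z⁆ = ⁅N y, z⁆ + ⁅y, N z⁆ := by
  rw [← coe_toLinearMap_ad] at h
  exact h.apply_lie y z

/-- A subalgebra with nondegenerate Killing form contains the Jordan–Chevalley components of its
elements. -/
theorem exists_jordan_mem_subalgebra (s : LieSubalgebra K L) [IsKilling K s] {x : L} (hx : x ∈ s) :
    ∃ y ∈ s, ∃ z ∈ s, x = y + z ∧ ⁅y, z⁆ = 0 ∧ (ad K L y).IsSemisimple ∧
      IsNilpotent (ad K L z) := by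
  obtain ⟨S, hS, N, hN, h⟩ := exists_isJordanChevalley (ad K L x)
  have hstab : ∀ p : Submodule K L, (∀ v ∈ p, ⁅x, v⁆ ∈ p) → ∀ v ∈ p, S v ∈ p :=
    fun p hp => mem_of_mem_adjoin hS hp
  have hSs : ∀ v ∈ s.toSubmodule, S v ∈ s.toSubmodule :=
    hstab _ fun v hv => s.lie_mem hx hv
  -- The semisimple part preserves `s` and is a derivation there, hence inner: it is `ad y` on `s`.
  let Ds : LieDerivation K s s :=
    { S.restrict hSs with
      leibniz' := fun u v => Subtype.ext (by
        have := (h.apply_lie_of_ad (u : L) v).1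
        change S ⁅(u : L), v⁆ = ⁅(u : L), S v⁆ - ⁅(v : L), S u⁆
        rw [this, ← lie_skew (S u)]; abel) }
  obtain ⟨y, hy⟩ := LieDerivation.IsKilling.exists_eq_ad Ds
  have hyS : ∀ w ∈ s, ⁅(y : L), w⁆ = S w := by
    intro w hw
    have : ⁅y, (⟨w, hw⟩ : s)⁆ = Ds ⟨w, hw⟩ := by rw [← hy, LieDerivation.ad_apply_apply]
    exact congrArg Subtype.val this
  set z : s := ⟨x, hx⟩ - y with hz
  have hxyz : x = y + z := by rw [hz]; simp
  have hNz : ∀ w, N w = ⁅x, w⁆ - S w := by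
    intro w
    have := LinearMap.congr_fun h.eq_add w
    rw [ad_apply, LinearMap.add_apply] at this
    rw [this]; abel
  have hzN : ∀ w ∈ s, ⁅(z : L), w⁆ = N w := by
    intro w hw
    rw [hNz, ← hyS w hw, hxyz, add_lie]; abel
  have hadz : IsNilpotent (ad K s z) := by
    have hNs : ∀ v ∈ s.toSubmodule, N v ∈ s.toSubmodule := by
      intro v hv
      rw [← hzN v hv]; exact s.lie_mem z.2 hv
    have : ad K s z = N.restrict hNs := by
      ext w; exact hzN w w.2
    rw [this]
    exact Module.End.isNilpotent.restrict hNs h.nilpotent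
  have hznil : IsNilpotent (ad K L z) := by
    have : IsNilpotent (toEnd K s L z) := isNilpotent_toEnd_of_isNilpotent_ad hadz
    exact this
  -- `η` measures the failure of `S = ad y` outside `s`. It commutes with `s`, and it is nilpotent
  -- because `η = ad z - N` is a difference of commuting nilpotents.
  set η : Module.End K L := S - ad K L y with hη
  have hηapp : ∀ v, η v = S v - ⁅(y : L), v⁆ := fun v => rfl
  have hηlie : ∀ w ∈ s, ∀ v, η ⁅w, v⁆ = ⁅w, η v⁆ := by
    intro w hw v
    rw [hηapp, hηapp, (h.apply_lie_of_ad w v).1, leibniz_lie (y : L), hyS w hw, lie_sub]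
    abel
  have hηz : Commute (ad K L z) η := by
    refine LinearMap.ext fun v => ?_
    exact (hηlie z z.2 v).symm
  have hηN : η = ad K L z - N := by
    ext v
    rw [hηapp, LinearMap.sub_apply, hNz, ad_apply]
    conv_rhs => rw [hxyz, add_lie]
    abel
  have hNcomm : Commute (ad K L z) N := by
    have : N = ad K L z - η := by rw [hηN]; abel
    rw [this]
    exact (Commute.refl _).sub_right hηz
  have hηnil : IsNilpotent η := by
    rw [hηN]; exact hNcomm.isNilpotent_sub hznil h.nilpotent
  let U : LieSubmodule K s L :=
    { LinearMap.ker η with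
      lie_mem := fun {w v} hv => by
        have hv' : η v = 0 := hv
        change η ⁅(w : L), v⁆ = 0
        rw [hηlie w w.2, hv', lie_zero] }
  -- A Weyl complement of `ker η` is stable under `η`, since `S` is a polynomial in `ad x`. There
  -- `η` is injective and nilpotent, so the complement is zero.
  obtain ⟨U', hU'⟩ := exists_isCompl_lieSubmodule U
  have hηU' : ∀ v ∈ U', η v ∈ U' := by
    intro v hv
    refine U'.sub_mem (hstab U'.toSubmodule (fun v hv => U'.lie_mem (x := ⟨x, hx⟩) hv) v hv) ?_
    exact U'.lie_mem (x := y) hv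
  have hU'0 : ∀ k, ∀ v ∈ U', (η ^ k) v = 0 → v = 0 := by
    intro k
    induction k with
    | zero => intro v _ h0; exact h0
    | succ k ih =>
      intro v hv h0
      rw [pow_succ, Module.End.mul_apply] at h0
      have h1 : η v = 0 := ih _ (hηU' v hv) h0
      exact Submodule.disjoint_def.mp hU'.disjoint v h1 hv
  have hη0 : η = 0 := by
    obtain ⟨k, hk⟩ := hηnil
    ext v
    have hv : v ∈ U.toSubmodule ⊔ U'.toSubmodule := by rw [hU'.sup_eq_top]; exact Submodule.mem_top
    obtain ⟨a, ha, b, hb, rfl⟩ := Submodule.mem_sup.mp hv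
    rw [hU'0 k b hb (by rw [hk]; rfl), add_zero]
    exact ha
  have hSy : S = ad K L y := sub_eq_zero.mp hη0
  refine ⟨y, y.2, z, z.2, hxyz, ?_, hSy ▸ h.semisimple, hznil⟩
  have h0 : S x = 0 := h.semisimple_apply_eq_zero (lie_self x)
  rw [← hyS x hx, hxyz, lie_add, lie_self, zero_add] at h0
  exact h0

end JordanInSubalgebra

/-! ### Conjugation by exponentials of nilpotent elements. -/

section Conjugation

variable {K L : Type*} [Field K] [CharZero K] [LieRing L] [LieAlgebra K L]

/-- An automorphism of the form `exp (ad w)`. -/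
theorem exists_lieEquiv_exp {w : L} (hw : IsNilpotent (ad K L w)) :
    ∃ φ : L ≃ₗ⁅K⁆ L, ∀ (p : Submodule K L) (y : L), (∀ i, ((ad K L w) ^ (i + 2)) y ∈ p) →
      φ y - (y + ⁅w, y⁆) ∈ p := by
  -- `LieDerivation.exp` works over `ℚ`, so scalars are restricted along `ℚ → K`.
  let _ : LieAlgebra ℚ L :=
    { Module.compHom L (algebraMap ℚ K) with
      lie_smul := fun q x y => lie_smul (algebraMap ℚ K q) x y }
  have hD : IsNilpotent (LieDerivation.ad K L w).toLinearMap := by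
    have : (LieDerivation.ad K L w).toLinearMap = ad K L w := coe_toLinearMap_ad w
    rwa [this]
  refine ⟨LieDerivation.exp (LieDerivation.ad K L w) hD, fun p y hp => ?_⟩
  rw [LieDerivation.exp_map_apply]
  obtain ⟨k, hk⟩ := hD
  -- The bound `k + 2` guarantees that the terms of order 0 and 1 can be split off the sum.
  have hk2 : (LieDerivation.ad K L w).toLinearMap ^ (k + 2) = 0 := by
    rw [pow_add, hk, zero_mul]
  have hcoe : (LieDerivation.ad K L w).toLinearMap = ad K L w := coe_toLinearMap_ad w
  rw [IsNilpotent.exp_eq_sum hk2, hcoe, Finset.sum_range_succ', Finset.sum_range_succ']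
  simp only [LinearMap.add_apply, LinearMap.sum_apply, LinearMap.smul_apply]
  have : ∀ a b c : L, a + b + c - (c + b) = a := fun a b c => by abel
  simp only [zero_add, pow_one, pow_zero, Nat.factorial_one, Nat.factorial_zero, Nat.cast_one,
    inv_one, one_smul, Module.End.one_apply, ad_apply, this]
  refine p.sum_mem fun i _ => ?_
  exact p.smul_of_tower_mem _ (hp i)

variable [FiniteDimensional K L]

/-- On each quotient of consecutive terms of the series `lcs L k`, `ν` acts as 0, so `u + ν` acts as
the nilpotent `u`. -/
theorem isNilpotent_ad_add {u ν : L} (hu : IsNilpotent (ad K L u)) (hν : ν ∈ adNilIdeal K L) :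
    IsNilpotent (ad K L (u + ν)) := by
  have key : ∀ k, ∃ j, ∀ v, ((ad K L (u + ν)) ^ j) v ∈ (adNilIdeal K L).lcs L k := by
    intro k
    induction k with
    | zero => exact ⟨0, fun v => LieSubmodule.mem_top _⟩
    | succ k ih =>
      obtain ⟨j, hj⟩ := ih
      obtain ⟨i, hi⟩ := hu
      have hU : ∀ i, ∀ v ∈ (adNilIdeal K L).lcs L k,
          ((ad K L u) ^ i) v ∈ (adNilIdeal K L).lcs L k := by
        intro i v hv
        induction i with
        | zero => exact hv
        | succ i ih => rw [pow_succ', Module.End.mul_apply]; exact LieSubmodule.lie_mem _ ih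
      have hdiff : ∀ i, ∀ v ∈ (adNilIdeal K L).lcs L k,
          ((ad K L (u + ν)) ^ i) v - ((ad K L u) ^ i) v ∈ (adNilIdeal K L).lcs L (k + 1) := by
        intro i v hv
        induction i with
        | zero => simp
        | succ i ih =>
          have : ((ad K L (u + ν)) ^ (i + 1)) v - ((ad K L u) ^ (i + 1)) v =
              ⁅u + ν, ((ad K L (u + ν)) ^ i) v - ((ad K L u) ^ i) v⁆ + ⁅ν, ((ad K L u) ^ i) v⁆ := by
            rw [pow_succ', pow_succ', Module.End.mul_apply, Module.End.mul_apply, ad_apply, ad_apply,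
              lie_sub, add_lie u ν (((ad K L u) ^ i) v)]
            abel
          rw [this]
          refine Submodule.add_mem (LieSubmodule.toSubmodule _) (LieSubmodule.lie_mem _ ih) ?_
          rw [LieIdeal.lcs_succ]
          exact LieSubmodule.lie_mem_lie hν (hU i v hv)
      refine ⟨i + j, fun v => ?_⟩
      rw [pow_add, Module.End.mul_apply]
      have := hdiff i _ (hj v)
      rwa [hi, LinearMap.zero_apply, sub_zero] at this
  obtain ⟨k, hk⟩ := exists_lcs_adNilIdeal_eq_bot K L
  obtain ⟨j, hj⟩ := key k
  refine ⟨j, LinearMap.ext fun v => ?_⟩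
  have := hj v
  rw [hk, LieSubmodule.mem_bot] at this
  exact this

/-- Let `t` be `ad`-semisimple and `u` be `ad`-nilpotent with `[t, u] = 0`. An element of
`t + u + n` is conjugate to one of the form `t + u + ν'` with `ν' ∈ n` commuting with `t`. -/
theorem exists_lieEquiv_add {t u ν : L} (htu : ⁅t, u⁆ = 0) (ht : (ad K L t).IsSemisimple)
    (hu : IsNilpotent (ad K L u)) (hν : ν ∈ adNilIdeal K L) :
    ∃ φ : L ≃ₗ⁅K⁆ L, ∃ ν' ∈ adNilIdeal K L, ⁅t, ν'⁆ = 0 ∧ φ (t + u + ν) = t + u + ν' := by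
  set n := adNilIdeal K L with hn
  have hcomm : Commute (ad K L t) (ad K L u) := by
    have : ⁅ad K L t, ad K L u⁆ = 0 := by rw [← LieHom.map_lie, htu, map_zero]
    rwa [LieRing.of_associative_ring_bracket, sub_eq_zero] at this
  -- Successive approximation: the error is pushed down the series `n.lcs L k`, which reaches 0.
  have key : ∀ k, ∃ φ : L ≃ₗ⁅K⁆ L, ∃ ν' ∈ n, ⁅t, ν'⁆ = 0 ∧
      φ (t + u + ν) - (t + u + ν') ∈ n ⊓ n.lcs L k := by
    intro k
    induction k with
    | zero =>
      refine ⟨LieEquiv.refl, 0, n.zero_mem, lie_zero t, ?_, LieSubmodule.mem_top _⟩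
      simpa using hν
    | succ k ih =>
      obtain ⟨φ, ν', hν', htν', hg⟩ := ih
      set g := φ (t + u + ν) - (t + u + ν') with hgdef
      set J : LieIdeal K L := n ⊓ n.lcs L k with hJ
      have hJsucc : ∀ a ∈ n, ∀ b ∈ J, ⁅a, b⁆ ∈ n ⊓ n.lcs L (k + 1) := by
        intro a ha b hb
        refine ⟨lie_mem_left K L n a b ha, ?_⟩
        change ⁅a, b⁆ ∈ n.lcs L (k + 1)
        rw [LieIdeal.lcs_succ]
        exact LieSubmodule.lie_mem_lie ha hb.2
      -- The error is `g₀ + ⁅t + u, w⁆` with `g₀` commuting with `t`. `g₀` is absorbed into `ν'`,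
      -- and `exp (ad w)` cancels the bracket up to terms one step deeper.
      obtain ⟨g₀, hg₀, w, hw, htg₀, hsum⟩ := exists_ker_add_apply (p := J.toSubmodule) ht hu hcomm
        (fun v hv => J.lie_mem hv) (fun v hv => J.lie_mem hv) hg
      rw [ad_apply, ad_apply] at hsum
      have hwn : w ∈ n := hw.1
      obtain ⟨ψ, hψ⟩ := exists_lieEquiv_exp (isNilpotent_ad_of_mem_adNilIdeal (K := K) hwn)
      refine ⟨φ.trans ψ, ν' + g₀, n.add_mem hν' hg₀.1, ?_, ?_⟩
      · rw [lie_add, htν', zero_add]; exact htg₀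
      · have hy : φ (t + u + ν) = t + u + ν' + g := by rw [hgdef]; abel
        have he := hψ (n ⊓ n.lcs L (k + 1) : LieIdeal K L).toSubmodule (φ (t + u + ν)) (by
          intro i
          induction i with
          | zero =>
            rw [zero_add, pow_two, Module.End.mul_apply]
            refine hJsucc w hwn _ ?_
            exact lie_mem_left K L J w _ hw
          | succ i ih =>
            rw [show i + 1 + 2 = (i + 2) + 1 from rfl, pow_succ', Module.End.mul_apply]
            exact LieSubmodule.lie_mem _ ih)
        set e := ψ (φ (t + u + ν)) - (φ (t + u + ν) + ⁅w, φ (t + u + ν)⁆) with hedef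
        have hfinal : (φ.trans ψ) (t + u + ν) - (t + u + (ν' + g₀)) =
            - ⁅ν', w⁆ + ⁅w, g⁆ + e := by
          have h1 : (φ.trans ψ) (t + u + ν) = φ (t + u + ν) + ⁅w, φ (t + u + ν)⁆ + e := by
            rw [hedef, LieEquiv.trans_apply]; abel
          have h2 : ⁅w, φ (t + u + ν)⁆ = - ⁅t, w⁆ - ⁅u, w⁆ - ⁅ν', w⁆ + ⁅w, g⁆ := by
            rw [hy, lie_add, lie_add, lie_add, ← lie_skew t, ← lie_skew u, ← lie_skew ν']
            abel
          rw [h1, h2, hy]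
          nth_rewrite 1 [hsum]
          abel
        rw [hfinal]
        refine Submodule.add_mem (LieSubmodule.toSubmodule _)
          (Submodule.add_mem (LieSubmodule.toSubmodule _) ?_ ?_) he
        · exact neg_mem (hJsucc ν' hν' w hw)
        · exact hJsucc w hwn g hg
  obtain ⟨k, hk⟩ := exists_lcs_adNilIdeal_eq_bot K L
  obtain ⟨φ, ν', hν', htν', h⟩ := key k
  refine ⟨φ, ν', hν', htν', ?_⟩
  have h2 := h.2
  rw [hk] at h2
  exact sub_eq_zero.mp ((LieSubmodule.mem_bot _).mp h2)

/-- The decomposition into `t` and `u + ν'` is carried back by the automorphism of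
`exists_lieEquiv_add`. -/
theorem exists_isJordanChevalley_ad {t u ν : L} (htu : ⁅t, u⁆ = 0) (ht : (ad K L t).IsSemisimple)
    (hu : IsNilpotent (ad K L u)) (hν : ν ∈ adNilIdeal K L) :
    ∃ p q : L, IsJordanChevalley (ad K L (t + u + ν)) (ad K L p) (ad K L q) := by
  obtain ⟨φ, ν', hν', htν', h⟩ := exists_lieEquiv_add htu ht hu hν
  have hφ : ∀ x v, φ ((ad K L (φ.symm x)) v) = ad K L x (φ v) := by
    intro x v
    rw [ad_apply, LieEquiv.map_lie, LieEquiv.apply_symm_apply, ad_apply]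
  refine ⟨φ.symm t, φ.symm (u + ν'), ?_, ?_, ?_, ?_⟩
  · rw [← map_add, ← map_add, ← add_assoc, ← h, LieEquiv.symm_apply_apply]
  · have h0 : ⁅ad K L (φ.symm t), ad K L (φ.symm (u + ν'))⁆ = 0 := by
      rw [← LieHom.map_lie, ← LieEquiv.map_lie, lie_add, htu, htν', add_zero, map_zero, map_zero]
    rwa [LieRing.of_associative_ring_bracket, sub_eq_zero] at h0
  · exact isSemisimple_of_injective (φ := (φ : L →ₗ[K] L)) φ.injective (hφ t) ht
  · obtain ⟨k, hk⟩ := isNilpotent_ad_add hu hν'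
    refine ⟨k, LinearMap.ext fun v => φ.injective ?_⟩
    have : ∀ k, φ (((ad K L (φ.symm (u + ν'))) ^ k) v) = ((ad K L (u + ν')) ^ k) (φ v) := by
      intro k
      induction k with
      | zero => rfl
      | succ k ih => rw [pow_succ', pow_succ', Module.End.mul_apply, Module.End.mul_apply, hφ, ih]
    change φ _ = φ 0
    rw [this, hk, map_zero, LinearMap.zero_apply]

end Conjugation

end GradedLie

namespace GradedLie

open LieModule LieAlgebra

/-! ### Homogeneous components, degree and depth. -/

section Grading

variable {K L : Type*} [Field K] [LieRing L] [LieAlgebra K L]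
variable (ℒ : ℤ → Submodule K L)

theorem negPart_le_iff {U : Submodule K L} : negPart ℒ ≤ U ↔ ∀ q < 0, ℒ q ≤ U :=
  iSup₂_le_iff

theorem le_negPart {q : ℤ} (hq : q < 0) : ℒ q ≤ negPart ℒ :=
  le_iSup₂ (f := fun (p : ℤ) (_ : p < 0) => ℒ p) q hq

theorem le_nonnegPart {q : ℤ} (hq : 0 ≤ q) : ℒ q ≤ nonnegPart ℒ :=
  le_iSup₂ (f := fun (p : ℤ) (_ : 0 ≤ p) => ℒ p) q hq

variable {ℒ} in
theorem eq_biSup_of_eq_iSup {U : Submodule K L} (hU : U = ⨆ p, U ⊓ ℒ p) {I : Set ℤ}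
    (hI : ∀ p, U ⊓ ℒ p ≠ ⊥ → p ∈ I) : U = ⨆ p ∈ I, U ⊓ ℒ p := by
  refine le_antisymm ?_ (iSup₂_le fun p _ => inf_le_left)
  conv_lhs => rw [hU]
  refine iSup_le fun p => ?_
  by_cases hp : U ⊓ ℒ p = ⊥
  · rw [hp]; exact bot_le
  · exact le_iSup₂ (f := fun (p : ℤ) (_ : p ∈ I) => U ⊓ ℒ p) p (hI p hp)

variable [GradedLieAlgebra ℒ]

/-- The projection of `L` to its homogeneous subspace of degree `p`. -/
def component (p : ℤ) : L →ₗ[K] L :=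
  (ℒ p).subtype ∘ₗ DirectSum.component K ℤ (fun i => ℒ i) p ∘ₗ
    (DirectSum.decomposeLinearEquiv ℒ).toLinearMap

theorem component_mem (p : ℤ) (x : L) : component ℒ p x ∈ ℒ p := (DirectSum.decompose ℒ x p).2

variable {ℒ}

theorem component_of_mem {p : ℤ} {x : L} (hx : x ∈ ℒ p) : component ℒ p x = x :=
  DirectSum.decompose_of_mem_same ℒ hx

theorem component_of_ne {p q : ℤ} {x : L} (hx : x ∈ ℒ p) (hpq : p ≠ q) : component ℒ q x = 0 :=
  DirectSum.decompose_of_mem_ne ℒ hx hpq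

theorem eq_zero_of_mem_of_mem {p q : ℤ} {x : L} (hp : x ∈ ℒ p) (hq : x ∈ ℒ q) (hpq : p ≠ q) :
    x = 0 := by
  rw [← component_of_mem hq, component_of_ne hp hpq]

theorem lie_mem_component {p q : ℤ} {x y : L} (hx : x ∈ ℒ p) (hy : y ∈ ℒ q) :
    ⁅x, y⁆ ∈ ℒ (p + q) :=
  SetLike.GradedBracket.bracket_mem hx hy

variable (ℒ)

theorem iSup_component_eq_top : ⨆ p, ℒ p = ⊤ :=
  (DirectSum.Decomposition.isInternal ℒ).submodule_iSup_eq_top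

theorem induction_component {P : L → Prop} (h : ∀ p, ∀ x ∈ ℒ p, P x) (h0 : P 0)
    (hadd : ∀ x y, P x → P y → P (x + y)) (x : L) : P x :=
  Submodule.iSup_induction ℒ (motive := P) (by rw [iSup_component_eq_top ℒ]; exact Submodule.mem_top) h h0 hadd

variable {ℒ} in
theorem ext_component {M : Type*} [AddCommGroup M] [Module K M] {f g : L →ₗ[K] M}
    (h : ∀ p, ∀ x ∈ ℒ p, f x = g x) : f = g :=
  LinearMap.ext fun x => induction_component ℒ (P := fun x => f x = g x) h (by simp)
    (fun x y hx hy => by rw [map_add, map_add, hx, hy]) x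

theorem component_lie (p : ℤ) {q : ℤ} (x : L) {y : L} (hy : y ∈ ℒ q) :
    component ℒ (p + q) ⁅x, y⁆ = ⁅component ℒ p x, y⁆ := by
  refine induction_component ℒ (P := fun x => component ℒ (p + q) ⁅x, y⁆ = ⁅component ℒ p x, y⁆)
    ?_ (by simp) (fun a b ha hb => by rw [add_lie, map_add, map_add, add_lie, ha, hb]) x
  intro r x hx
  have hxy := lie_mem_component hx hy
  by_cases hrp : r = p
  · subst hrp
    rw [component_of_mem hxy, component_of_mem hx]
  · rw [component_of_ne hxy (by omega), component_of_ne hx hrp, zero_lie]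

variable {ℒ} in
theorem component_mem_of_eq_iSup {U : Submodule K L} (hU : U = ⨆ p, U ⊓ ℒ p) (p : ℤ) {x : L}
    (hx : x ∈ U) : component ℒ p x ∈ U := by
  have : U ≤ U.comap (component ℒ p) := by
    conv_lhs => rw [hU]
    refine iSup_le fun q y hy => ?_
    rw [Submodule.mem_comap]
    by_cases hqp : q = p
    · subst hqp; rw [component_of_mem hy.2]; exact hy.1
    · rw [component_of_ne hy.2 hqp]; exact U.zero_mem
  exact this hx

variable {ℒ} in
theorem eq_zero_of_lie_mem_negPart (hqe : IsQuasiEffective ℒ) {p : ℤ} (hp : 0 < p) {X : L}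
    (hX : X ∈ ℒ p) (h : ∀ q < 0, ∀ Y ∈ ℒ q, ⁅X, Y⁆ ∈ negPart ℒ) : X = 0 := by
  refine eq_zero_of_mem_of_mem hX (hqe.mem_zero X (le_nonnegPart ℒ hp.le hX) fun Y hY => ?_) hp.ne'
  exact (negPart_le_iff ℒ (U := (negPart ℒ).comap (ad K L X : L →ₗ[K] L))).mpr h hY

variable {ℒ} in
theorem sum_component {s : Finset ℤ} (hs : ∀ p, p ∉ s → ℒ p = ⊥) (x : L) :
    ∑ p ∈ s, component ℒ p x = x := by
  refine induction_component ℒ (P := fun x => ∑ p ∈ s, component ℒ p x = x) ?_ (by simp)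
    (fun a b ha hb => by simp only [map_add, Finset.sum_add_distrib, ha, hb]) x
  intro p x hx
  by_cases hp : p ∈ s
  · rw [Finset.sum_eq_single_of_mem p hp fun q _ hq => component_of_ne hx hq.symm,
      component_of_mem hx]
  · rw [hs p hp, Submodule.mem_bot] at hx
    simp [hx]

variable [FiniteDimensional K L]

theorem exists_bound_degree : ∃ d : ℕ, ∀ p : ℤ, p ∉ Finset.Icc (-(d : ℤ)) d → ℒ p = ⊥ := by
  have hfin : {p | ℒ p ≠ ⊥}.Finite := WellFoundedGT.finite_ne_bot_of_iSupIndep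
    (DirectSum.Decomposition.isInternal ℒ).submodule_iSupIndep
  obtain ⟨d, hd⟩ := (hfin.image Int.natAbs).bddAbove
  refine ⟨d, fun p hp => ?_⟩
  by_contra hne
  have := hd ⟨p, hne, rfl⟩
  rw [Finset.mem_Icc] at hp
  omega

theorem eq_iSup_of_component_mem {U : Submodule K L}
    (hU : ∀ p, ∀ x ∈ U, component ℒ p x ∈ U) : U = ⨆ p, U ⊓ ℒ p := by
  refine le_antisymm (fun x hx => ?_) (iSup_le fun p => inf_le_left)
  obtain ⟨d, hd⟩ := exists_bound_degree ℒ
  rw [← sum_component hd x]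
  exact Submodule.sum_mem _ fun p _ =>
    Submodule.mem_iSup_of_mem p ⟨hU p x hx, component_mem ℒ p x⟩

variable {ℒ} in
/-- An endomorphism of nonzero degree is nilpotent. -/
theorem isNilpotent_of_degree_ne_zero {T : Module.End K L} {c : ℤ} (hc : c ≠ 0)
    (hT : ∀ p, ∀ x ∈ ℒ p, T x ∈ ℒ (p + c)) : IsNilpotent T := by
  obtain ⟨d, hd⟩ := exists_bound_degree ℒ
  have hpow : ∀ k : ℕ, ∀ p, ∀ x ∈ ℒ p, (T ^ k) x ∈ ℒ (p + k * c) := by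
    intro k
    induction k with
    | zero => intro p x hx; simpa using hx
    | succ k ih =>
      intro p x hx
      rw [pow_succ', Module.End.mul_apply]
      have := hT _ _ (ih p x hx)
      rwa [show p + ↑(k + 1) * c = p + k * c + c by push_cast; ring]
  -- Degrees live in `[-d, d]`, and `2 * d + 1` shifts by a nonzero integer leave this interval.
  refine ⟨2 * d + 1, ext_component (ℒ := ℒ) fun p x hx => ?_⟩
  have h := hpow (2 * d + 1) p x hx
  by_cases hp : p ∈ Finset.Icc (-(d : ℤ)) d
  · rw [hd (p + ↑(2 * d + 1) * c), Submodule.mem_bot] at h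
    · exact h
    · rw [Finset.mem_Icc] at hp ⊢
      rintro ⟨h1, h2⟩
      push_cast at h1 h2
      rcases lt_or_gt_of_ne hc with hc | hc
      · nlinarith
      · nlinarith
  · rw [hd p hp, Submodule.mem_bot] at hx
    simp [hx]

variable {ℒ} in
theorem isNilpotent_ad_of_mem {p : ℤ} (hp : p ≠ 0) {x : L} (hx : x ∈ ℒ p) :
    IsNilpotent (ad K L x) :=
  isNilpotent_of_degree_ne_zero hp fun q y hy => by
    rw [add_comm]; exact lie_mem_component hx hy

variable {ℒ} in
theorem killingForm_eq_zero_of_mem {p q : ℤ} (hpq : p + q ≠ 0) {x y : L} (hx : x ∈ ℒ p)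
    (hy : y ∈ ℒ q) : killingForm K L x y = 0 := by
  rw [killingForm_apply_apply]
  refine (LinearMap.isNilpotent_trace_of_isNilpotent
    (isNilpotent_of_degree_ne_zero (ℒ := ℒ) hpq fun r z hz => ?_)).eq_zero
  have := lie_mem_component hx (lie_mem_component hy hz)
  rwa [show r + (p + q) = p + (q + r) by ring]

section Depth

variable (U : Submodule K L)

variable {U} in
theorem neg_le_depth {p : ℤ} (hp : U ⊓ ℒ p ≠ ⊥) : -p ≤ depth ℒ U := by
  -- Finitely many degrees occur, so the set is bounded above and `sSup` is not a default value.
  refine le_csSup ?_ (by simpa using hp)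
  obtain ⟨d, hd⟩ := exists_bound_degree ℒ
  refine ⟨d, fun q hq => ?_⟩
  by_contra hlt
  refine hq ?_
  rw [hd (-q) (by rw [Finset.mem_Icc]; omega), inf_bot_eq]

end Depth

end Grading

/-! ### The Euler derivation. -/

section Euler

variable {K L : Type*} [Field K] [LieRing L] [LieAlgebra K L]
variable (ℒ : ℤ → Submodule K L) [GradedLieAlgebra ℒ]

/-- The derivation acting on the homogeneous subspace of degree `p` as multiplication by `p`. -/
def euler : LieDerivation K L L :=
  LieDerivation.ofGrading ℒ (Int.castAddHom K)

variable {ℒ} in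
theorem euler_apply {p : ℤ} {x : L} (hx : x ∈ ℒ p) : euler ℒ x = (p : K) • x :=
  LieDerivation.ofGrading_apply_apply ℒ (Int.castAddHom K) hx

variable {ℒ} in
theorem aeval_euler_apply (P : Polynomial K) {p : ℤ} {x : L} (hx : x ∈ ℒ p) :
    Polynomial.aeval (euler ℒ : L →ₗ[K] L) P x = P.eval (p : K) • x := by
  induction P using Polynomial.induction_on' with
  | add P Q hP hQ => rw [map_add, LinearMap.add_apply, hP, hQ, Polynomial.eval_add, add_smul]
  | monomial n a =>
    rw [Polynomial.aeval_monomial, Polynomial.eval_monomial, mul_smul, Module.End.mul_apply,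
      Module.algebraMap_end_apply]
    congr 1
    induction n with
    | zero => simp
    | succ n ih =>
      rw [pow_succ', Module.End.mul_apply, ih, map_smul, pow_succ, mul_smul]
      congr 1
      exact euler_apply hx

variable [CharZero K] [FiniteDimensional K L]

theorem isSemisimple_euler : Module.End.IsSemisimple (euler ℒ : L →ₗ[K] L) := by
  obtain ⟨d, hd⟩ := exists_bound_degree ℒ
  set s := Finset.Icc (-(d : ℤ)) d
  refine Module.End.isSemisimple_of_squarefree_aeval_eq_zero
    (p := ∏ i : s, (Polynomial.X - Polynomial.C ((i : ℤ) : K))) ?_ ?_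
  · refine (Polynomial.separable_prod_X_sub_C_iff.mpr ?_).squarefree
    exact fun i j hij => Subtype.ext (Int.cast_injective hij)
  · refine ext_component (ℒ := ℒ) fun p x hx => ?_
    rw [aeval_euler_apply _ hx, LinearMap.zero_apply, Polynomial.eval_prod]
    by_cases hp : p ∈ s
    · rw [Finset.prod_eq_zero (Finset.mem_univ (⟨p, hp⟩ : s)) (by simp), zero_smul]
    · rw [hd p hp, Submodule.mem_bot] at hx
      rw [hx, smul_zero]

variable {ℒ} in
-- Lagrange interpolation: up to a nonzero scalar, the projection to degree `p` is a polynomial in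
-- the Euler derivation, so stability under the latter implies gradedness.
theorem component_mem_of_euler_mem {U : Submodule K L} (hU : ∀ x ∈ U, euler ℒ x ∈ U) (p : ℤ)
    {x : L} (hx : x ∈ U) : component ℒ p x ∈ U := by
  obtain ⟨d, hd⟩ := exists_bound_degree ℒ
  set s := Finset.Icc (-(d : ℤ)) d
  let P : Polynomial K := ∏ i ∈ s.erase p, (Polynomial.X - Polynomial.C ((i : ℤ) : K))
  have hP : P.eval (p : K) ≠ 0 := by
    rw [Polynomial.eval_prod, Finset.prod_ne_zero_iff]
    intro i hi
    rw [Polynomial.eval_sub, Polynomial.eval_X, Polynomial.eval_C, sub_ne_zero]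
    exact fun h => (Finset.mem_erase.mp hi).1 (Int.cast_injective h).symm
  have hcomp : P.eval (p : K) • component ℒ p =
      Polynomial.aeval (euler ℒ : L →ₗ[K] L) P := by
    refine ext_component (ℒ := ℒ) fun q x hx => ?_
    rw [aeval_euler_apply _ hx, LinearMap.smul_apply]
    by_cases hqp : q = p
    · subst hqp; rw [component_of_mem hx]
    · rw [component_of_ne hx hqp, smul_zero]
      by_cases hq : q ∈ s
      · rw [Polynomial.eval_prod, Finset.prod_eq_zero (Finset.mem_erase.mpr ⟨hqp, hq⟩) (by simp),
          zero_smul]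
      · rw [hd q hq, Submodule.mem_bot] at hx
        rw [hx, smul_zero]
  have := mem_of_mem_adjoin (A := (euler ℒ : L →ₗ[K] L))
    (Polynomial.aeval_mem_adjoin_singleton K _ (p := P)) hU x hx
  rw [← hcomp, LinearMap.smul_apply] at this
  exact (U.smul_mem_iff hP).mp this

end Euler

/-! ### Degrees of the radical. -/

section Radical

variable {K L : Type*} [Field K] [CharZero K] [LieRing L] [LieAlgebra K L] [FiniteDimensional K L]
variable {ℒ : ℤ → Submodule K L}

theorem eq_zero_of_mem_adNilIdeal (hred : IsOfReductiveType ℒ) {x : L} (hx : x ∈ adNilIdeal K L)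
    (hx0 : x ∈ ℒ 0) : x = 0 := by
  have : x ∈ (nilradical K L).toSubmodule ⊓ ℒ 0 := ⟨adNilIdeal_le_nilradical K L hx, hx0⟩
  rwa [hred, Submodule.mem_bot] at this

variable [GradedLieAlgebra ℒ]

theorem component_mem_radical (p : ℤ) {x : L} (hx : x ∈ radical K L) :
    component ℒ p x ∈ radical K L :=
  component_mem_of_euler_mem (U := (radical K L).toSubmodule)
    (fun _ hy => derivation_mem_radical (euler ℒ) hy) p hx

theorem mem_adNilIdeal_of_mem {p : ℤ} (hp : p ≠ 0) {x : L} (hx : x ∈ radical K L) (hxp : x ∈ ℒ p) :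
    x ∈ adNilIdeal K L :=
  (mem_adNilIdeal_iff hx).mpr (isNilpotent_ad_of_mem hp hxp)

theorem sub_component_zero_mem_adNilIdeal {x : L} (hx : x ∈ radical K L) :
    x - component ℒ 0 x ∈ adNilIdeal K L := by
  obtain ⟨d, hd⟩ := exists_bound_degree ℒ
  have h0 : (0 : ℤ) ∈ Finset.Icc (-(d : ℤ)) d := by rw [Finset.mem_Icc]; omega
  have : x - component ℒ 0 x = ∑ p ∈ (Finset.Icc (-(d : ℤ)) d).erase 0, component ℒ p x := by
    rw [sub_eq_iff_eq_add, Finset.sum_erase_add _ _ h0, sum_component hd]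
  rw [this]
  refine Submodule.sum_mem (adNilIdeal K L).toSubmodule fun p hp => ?_
  exact mem_adNilIdeal_of_mem (Finset.mem_erase.mp hp).1 (component_mem_radical p hx)
    (component_mem ℒ p x)

/-- The bracket lies in `adNilIdeal` and has degree 0. -/
theorem lie_eq_zero_of_mem_radical (hred : IsOfReductiveType ℒ) {A B : L} (hA0 : A ∈ ℒ 0)
    (hB : B ∈ radical K L) (hB0 : B ∈ ℒ 0) : ⁅A, B⁆ = 0 :=
  eq_zero_of_mem_adNilIdeal hred (lie_mem_adNilIdeal A hB) (lie_mem_component hA0 hB0)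

/-- Brackets of `x` with m land in `adNilIdeal`: those of degree 0 vanish by reductive type and
those of positive degree by induction. So `x` normalizes m, and quasi-effectiveness applies. -/
theorem eq_zero_of_mem_radical_of_pos (hqe : IsQuasiEffective ℒ) (hred : IsOfReductiveType ℒ)
    {p : ℤ} (hp : 0 < p) {x : L} (hx : x ∈ radical K L) (hxp : x ∈ ℒ p) : x = 0 := by
  obtain ⟨n, rfl⟩ := Int.eq_ofNat_of_zero_le hp.le
  induction n using Nat.strong_induction_on generalizing x with
  | _ n ih =>
  refine eq_zero_of_lie_mem_negPart hqe hp hxp fun q hq y hy => ?_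
  have hn : ⁅x, y⁆ ∈ adNilIdeal K L := by
    rw [← lie_skew]; exact neg_mem (lie_mem_adNilIdeal y hx)
  have hxy := lie_mem_component hxp hy
  rcases lt_trichotomy ((n : ℤ) + q) 0 with h | h | h
  · exact le_negPart ℒ h hxy
  · rw [h] at hxy
    rw [eq_zero_of_mem_adNilIdeal hred hn hxy]; exact Submodule.zero_mem _
  · rw [ih ((n : ℤ) + q).toNat (by omega) (adNilIdeal_le_radical K L hn) (by omega)
      (by rwa [Int.toNat_of_nonneg h.le])]
    exact Submodule.zero_mem _

theorem radical_eq_iSup (hqe : IsQuasiEffective ℒ) (hred : IsOfReductiveType ℒ) :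
    (radical K L).toSubmodule = ⨆ p ∈ Set.Icc (-depth ℒ (radical K L).toSubmodule) 0,
      (radical K L).toSubmodule ⊓ ℒ p := by
  refine eq_biSup_of_eq_iSup
    (eq_iSup_of_component_mem ℒ fun p x hx => component_mem_radical p hx) fun p hp => ?_
  refine ⟨neg_le.mp (neg_le_depth ℒ hp), not_lt.mp fun h => hp ?_⟩
  exact (Submodule.eq_bot_iff _).mpr fun x hx => eq_zero_of_mem_radical_of_pos hqe hred h hx.1 hx.2

end Radical

/-! ### Graded Levi factors and their depth. -/

section Levi

variable {K L : Type*} [Field K] [CharZero K] [LieRing L] [LieAlgebra K L] [FiniteDimensional K L]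
variable {ℒ : ℤ → Submodule K L} [GradedLieAlgebra ℒ]

theorem isGradedLeviFactor {s : LieSubalgebra K L} (hs : ∀ x ∈ s, euler ℒ x ∈ s)
    (h : IsCompl s.toSubmodule (radical K L).toSubmodule) : IsGradedLeviFactor ℒ s where
  graded := eq_iSup_of_component_mem ℒ fun p _ hx =>
    component_mem_of_euler_mem (U := s.toSubmodule) hs p hx
  semisimple := by
    have := isKilling_of_isCompl_radical s h
    infer_instance
  isCompl := h

theorem exists_isGradedLeviFactor_le (c : LieSubalgebra K L) (hcE : ∀ x ∈ c, euler ℒ x ∈ c)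
    (hc : c.toSubmodule ⊔ (radical K L).toSubmodule = ⊤) :
    ∃ s ≤ c, IsGradedLeviFactor ℒ s := by
  obtain ⟨s, hsc, hsE, hs⟩ := exists_levi (euler ℒ) (isSemisimple_euler ℒ) c hcE hc
  exact ⟨s, hsc, isGradedLeviFactor hsE hs⟩

/-- The right-hand side does not involve `s`, so all graded Levi factors occupy the same degrees. -/
theorem IsGradedLeviFactor.inf_ne_bot_iff {s : LieSubalgebra K L} (hs : IsGradedLeviFactor ℒ s)
    {p : ℤ} : s.toSubmodule ⊓ ℒ p ≠ ⊥ ↔ ¬ ℒ p ≤ (radical K L).toSubmodule := by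
  refine not_congr ⟨fun h x hx => ?_, fun h => ?_⟩
  · have hx' : x ∈ s.toSubmodule ⊔ (radical K L).toSubmodule := by
      rw [hs.isCompl.sup_eq_top]; exact Submodule.mem_top
    obtain ⟨a, ha, b, hb, rfl⟩ := Submodule.mem_sup.mp hx'
    have ha0 : component ℒ p a ∈ s.toSubmodule ⊓ ℒ p :=
      ⟨component_mem_of_eq_iSup hs.graded p ha, component_mem ℒ p a⟩
    rw [h, Submodule.mem_bot] at ha0
    rw [← component_of_mem hx, map_add, ha0, zero_add]
    exact component_mem_radical p hb
  · exact (Submodule.eq_bot_iff _).mpr fun x hx =>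
      Submodule.disjoint_def.mp hs.isCompl.disjoint x hx.1 (h hx.2)

/-- If `ℒ (-p)` lies in the radical with `p ≠ 0`, it consists of `ad`-nilpotent elements and is
Killing-orthogonal to everything. Since `ℒ p` can only pair with `ℒ (-p)`, it too is orthogonal to
everything, hence radical. -/
theorem not_le_radical_neg {p : ℤ} (hp : ¬ ℒ p ≤ (radical K L).toSubmodule) :
    ¬ ℒ (-p) ≤ (radical K L).toSubmodule := by
  intro h
  have hp0 : p ≠ 0 := by
    rintro rfl
    exact hp (by simpa using h)
  refine hp fun x hx => ?_
  rw [LieSubmodule.mem_toSubmodule, radical_eq_killingCompl, LieIdeal.mem_killingCompl]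
  intro y _
  refine induction_component ℒ (P := fun y => killingForm K L y x = 0) ?_ (by simp)
    (fun a b ha hb => by rw [map_add, LinearMap.add_apply, ha, hb, add_zero]) y
  intro q y hy
  by_cases hq : q = -p
  · subst hq
    exact killingForm_eq_zero_of_mem_adNilIdeal
      (mem_adNilIdeal_of_mem (neg_ne_zero.mpr hp0) (h hy) hy) x
  · exact killingForm_eq_zero_of_mem (by omega) hy hx

theorem IsGradedLeviFactor.depth_eq {s s' : LieSubalgebra K L} (hs : IsGradedLeviFactor ℒ s)
    (hs' : IsGradedLeviFactor ℒ s') : depth ℒ s.toSubmodule = depth ℒ s'.toSubmodule := by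
  unfold depth
  congr 1
  ext p
  exact hs.inf_ne_bot_iff.trans hs'.inf_ne_bot_iff.symm

theorem IsGradedLeviFactor.eq_iSup {s : LieSubalgebra K L} (hs : IsGradedLeviFactor ℒ s) :
    s.toSubmodule = ⨆ p ∈ Set.Icc (-depth ℒ s.toSubmodule) (depth ℒ s.toSubmodule),
      s.toSubmodule ⊓ ℒ p := by
  refine eq_biSup_of_eq_iSup hs.graded fun p hp => ⟨neg_le.mp (neg_le_depth ℒ hp), ?_⟩
  have := neg_le_depth ℒ (hs.inf_ne_bot_iff.mpr (not_le_radical_neg (hs.inf_ne_bot_iff.mp hp)))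
  rwa [neg_neg] at this

end Levi

/-! ### The decomposability criterion and a Levi factor commuting with r₀. -/

section Decomposable

variable {K L : Type*} [Field K] [CharZero K] [LieRing L] [LieAlgebra K L] [FiniteDimensional K L]
variable {ℒ : ℤ → Submodule K L} [GradedLieAlgebra ℒ]

theorem isSemisimple_ad_of_isDecomposable (hred : IsOfReductiveType ℒ) (hdec : IsDecomposable K L)
    {A : L} (hA : A ∈ radical K L) (hA0 : A ∈ ℒ 0) : (ad K L A).IsSemisimple := by
  obtain ⟨S, -, N, hN, h⟩ := exists_isJordanChevalley (ad K L A)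
  have hNmem : N ∈ (ad K L).range := by
    have : N ∈ decomposableEnvelope (ad K L).range :=
      LieSubalgebra.subset_lieSpan ⟨ad K L A, LieHom.mem_range_self _ A, S, N, h, Or.inr rfl⟩
    have hd : decomposableEnvelope (ad K L).range = (ad K L).range := hdec
    rwa [hd] at this
  obtain ⟨C, hC⟩ := hNmem
  -- `N` is a polynomial in `ad A`, so it has degree 0 and only the degree 0 component of `C`
  -- matters.
  have hNC : N = ad K L (component ℒ 0 C) := by
    refine ext_component (ℒ := ℒ) fun p x hx => ?_
    have hNx : N x ∈ ℒ p := mem_of_mem_adjoin hN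
      (fun v hv => by simpa using lie_mem_component hA0 hv) x hx
    rw [← component_of_mem hNx, ad_apply, ← component_lie ℒ 0 C hx, zero_add, ← hC]
    rfl
  set C₀ := component ℒ 0 C
  have hC₀r : C₀ ∈ radical K L := by
    -- `A` acts as 0 on `L` modulo the radical, hence so does its nilpotent part; thus `C₀` is
    -- central in a centreless quotient.
    have hker : ∀ v, (quotientLieHom (radical K L) : L →ₗ[K] L ⧸ radical K L) (N v) = 0 := by
      intro v
      refine (h.intertwine (A' := (0 : Module.End K (L ⧸ radical K L)))
        ⟨(add_zero 0).symm, Commute.zero_left _, Module.End.isSemisimple_zero, IsNilpotent.zero⟩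
        (φ := (quotientLieHom (radical K L) : L →ₗ[K] L ⧸ radical K L)) ?_ v).2
      intro v
      refine quotientLieHom_eq_zero_iff.mpr ?_
      rw [ad_apply]
      exact lie_mem_left K L _ A v hA
    have := isKilling_quotient_radical (K := K) (L := L)
    have hcen : quotientLieHom (radical K L) C₀ ∈ LieAlgebra.center K (L ⧸ radical K L) := by
      rw [LieModule.mem_maxTrivSubmodule]
      intro y
      obtain ⟨v, rfl⟩ := quotientLieHom_surjective _ y
      have := hker v
      rw [hNC] at this
      rw [← lie_skew, ← LieHom.map_lie, neg_eq_zero]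
      exact this
    rw [LieAlgebra.center_eq_bot, LieSubmodule.mem_bot] at hcen
    exact quotientLieHom_eq_zero_iff.mp hcen
  have hC₀ : C₀ = 0 := eq_zero_of_mem_adNilIdeal hred
    ((mem_adNilIdeal_iff hC₀r).mpr (hNC ▸ h.nilpotent)) (component_mem ℒ 0 C)
  have := h.eq_add
  rw [hNC, hC₀, map_zero, add_zero] at this
  rw [this]
  exact h.semisimple

theorem isSemisimple_rho_iff (hqe : IsQuasiEffective ℒ) (A : structureSubalgebra ℒ) :
    (rho ℒ A).IsSemisimple ↔ (ad K L (A : L)).IsSemisimple := by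
  refine ⟨fun hss => ?_, isSemisimple_of_injective (φ := (negPart ℒ).subtype)
    (negPart ℒ).injective_subtype fun v => rfl⟩
  obtain ⟨S, -, N, hN, h⟩ := exists_isJordanChevalley (ad K L (A : L))
  have hNm : ∀ v ∈ negPart ℒ, N v = 0 := by
    intro v hv
    have hρ : IsJordanChevalley (rho ℒ A) (rho ℒ A) 0 :=
      ⟨(add_zero _).symm, Commute.zero_right _, hss, IsNilpotent.zero⟩
    exact (hρ.intertwine h (φ := (negPart ℒ).subtype) (fun v => rfl) ⟨v, hv⟩).2.symm
  have hNdeg : ∀ p, ∀ v ∈ ℒ p, N v ∈ ℒ p := fun p =>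
    mem_of_mem_adjoin hN fun v hv => by simpa using lie_mem_component A.2 hv
  -- `N` is a derivation killing m, so `⁅N v, y⁆ = N ⁅v, y⁆` for `y ∈ m`. By induction on the degree
  -- this vanishes or lies in m, and quasi-effectiveness gives `N v = 0`.
  have hNnonneg : ∀ n : ℕ, ∀ v ∈ ℒ n, N v = 0 := by
    intro n
    induction n using Nat.strong_induction_on with
    | _ n ih =>
    intro v hv
    have hlie : ∀ y ∈ negPart ℒ, ⁅N v, y⁆ = N ⁅v, y⁆ := by
      intro y hy
      rw [(h.apply_lie_of_ad v y).2, hNm y hy, lie_zero, add_zero]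
    rcases Nat.eq_zero_or_pos n with rfl | hn
    · refine hqe.eq_zero _ (hNdeg _ v hv) fun y hy => ?_
      rw [hlie y hy, hNm _ (lie_mem_negPart ℒ hv hy)]
    · refine eq_zero_of_lie_mem_negPart hqe (by exact_mod_cast hn) (hNdeg _ v hv) fun q hq y hy => ?_
      rw [hlie y (le_negPart ℒ hq hy)]
      have hvy := lie_mem_component hv hy
      rcases lt_or_ge ((n : ℤ) + q) 0 with hlt | hge
      · rw [hNm _ (le_negPart ℒ hlt hvy)]; exact Submodule.zero_mem _
      · rw [ih ((n : ℤ) + q).toNat (by omega) _ (by rwa [Int.toNat_of_nonneg hge])]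
        exact Submodule.zero_mem _
  have hN0 : N = 0 := by
    refine ext_component (ℒ := ℒ) fun p x hx => ?_
    rcases lt_or_ge p 0 with hp | hp
    · exact hNm x (le_negPart ℒ hp hx)
    · exact hNnonneg p.toNat x (by rwa [Int.toNat_of_nonneg hp])
  rw [h.eq_add, hN0, add_zero]
  exact h.semisimple

/-- Each step intersects `c` with the centralizer of one `A ∈ r₀`. Semisimplicity gives `x = u + ⁅A,
w⁆` with `⁅A, u⁆ = 0` and `⁅A, w⁆` radical, so the supplement property survives; r₀ stays inside
because it is abelian. -/
theorem exists_supplement_commuting (hred : IsOfReductiveType ℒ)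
    (hss : ∀ A ∈ radical K L, A ∈ ℒ 0 → (ad K L A).IsSemisimple) (c : LieSubalgebra K L)
    (hcE : ∀ x ∈ c, euler ℒ x ∈ c) (hc0 : ∀ A ∈ radical K L, A ∈ ℒ 0 → A ∈ c)
    (hc : c.toSubmodule ⊔ (radical K L).toSubmodule = ⊤) :
    ∃ c' : LieSubalgebra K L, (∀ x ∈ c', euler ℒ x ∈ c') ∧
      c'.toSubmodule ⊔ (radical K L).toSubmodule = ⊤ ∧
      ∀ A ∈ radical K L, A ∈ ℒ 0 → ∀ x ∈ c', ⁅A, x⁆ = 0 := by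
  induction hn : Module.finrank K c using Nat.strong_induction_on generalizing c with
  | _ n ih =>
  by_cases hcomm : ∀ A ∈ radical K L, A ∈ ℒ 0 → ∀ x ∈ c, ⁅A, x⁆ = 0
  · exact ⟨c, hcE, hc, hcomm⟩
  push Not at hcomm
  obtain ⟨A, hA, hA0, x₀, hx₀, hAx₀⟩ := hcomm
  let c' : LieSubalgebra K L :=
    { c.toSubmodule ⊓ LinearMap.ker (ad K L A : L →ₗ[K] L) with
      lie_mem' := fun {x y} hx hy => by
        refine ⟨c.lie_mem hx.1 hy.1, ?_⟩
        have h1 : ⁅A, x⁆ = 0 := hx.2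
        have h2 : ⁅A, y⁆ = 0 := hy.2
        change ⁅A, ⁅x, y⁆⁆ = 0
        rw [leibniz_lie, h1, h2, zero_lie, lie_zero, add_zero] }
  have hmem : ∀ x, x ∈ c' ↔ x ∈ c ∧ ⁅A, x⁆ = 0 := fun x => Iff.rfl
  have hlt : c'.toSubmodule < c.toSubmodule :=
    lt_of_le_of_ne (fun x hx => ((hmem x).mp hx).1) fun h =>
      hAx₀ ((hmem x₀).mp (show x₀ ∈ c'.toSubmodule by rw [h]; exact hx₀)).2
  refine ih (Module.finrank K c') (hn ▸ Submodule.finrank_lt_finrank_of_lt hlt) c' ?_ ?_ ?_ rfl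
  · intro x hx
    rw [hmem] at hx ⊢
    refine ⟨hcE x hx.1, ?_⟩
    have h1 := (euler ℒ).apply_lie_eq_add A x
    rw [hx.2, map_zero, euler_apply hA0, Int.cast_zero, zero_smul, zero_lie, add_zero] at h1
    exact h1.symm
  · intro B hB hB0
    exact (hmem B).mpr ⟨hc0 B hB hB0, lie_eq_zero_of_mem_radical hred hA0 hB hB0⟩
  · rw [eq_top_iff, ← hc]
    refine sup_le (fun x hx => ?_) le_sup_right
    obtain ⟨u, hu, w, -, hAu, hsum⟩ := exists_ker_add_apply (p := c.toSubmodule) (hss A hA hA0)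
      IsNilpotent.zero (Commute.zero_right _) (fun v hv => c.lie_mem (hc0 A hA hA0) hv)
      (fun v _ => by rw [LinearMap.zero_apply]; exact Submodule.zero_mem _) hx
    rw [hsum, LinearMap.zero_apply, add_zero]
    exact Submodule.add_mem_sup ((hmem u).mpr ⟨hu, hAu⟩) (lie_mem_left K L _ A w hA)

theorem exists_isGradedLeviFactor_commuting (hred : IsOfReductiveType ℒ)
    (hss : ∀ A ∈ radical K L, A ∈ ℒ 0 → (ad K L A).IsSemisimple) :
    ∃ s : LieSubalgebra K L, IsGradedLeviFactor ℒ s ∧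
      ∀ A ∈ radical K L, A ∈ ℒ 0 → ∀ x ∈ s, ⁅A, x⁆ = 0 := by
  obtain ⟨c, hcE, hc, hcomm⟩ := exists_supplement_commuting hred hss ⊤
    (fun _ _ => LieSubalgebra.mem_top _) (fun _ _ _ => LieSubalgebra.mem_top _)
    (by rw [LieSubalgebra.top_toSubmodule, top_sup_eq])
  obtain ⟨s, hsc, hs⟩ := exists_isGradedLeviFactor_le c hcE hc
  exact ⟨s, hs, fun A hA hA0 x hx => hcomm A hA hA0 x (hsc hx)⟩

theorem isDecomposable_of_exists_isJordanChevalley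
    (h : ∀ x : L, ∃ p q : L, IsJordanChevalley (ad K L x) (ad K L p) (ad K L q)) :
    IsDecomposable K L := by
  refine le_antisymm (LieSubalgebra.lieSpan_le.mpr ?_) ?_
  · rintro X ⟨-, ⟨x, rfl⟩, S, N, hSN, hX⟩
    obtain ⟨p, q, hpq⟩ := h x
    obtain ⟨rfl, rfl⟩ := hSN.unique hpq
    rcases hX with rfl | rfl
    · exact LieHom.mem_range_self _ p
    · exact LieHom.mem_range_self _ q
  · rintro X ⟨x, rfl⟩
    obtain ⟨p, q, hpq⟩ := h x
    have hx : ad K L x ∈ (ad K L).range := LieHom.mem_range_self _ x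
    change ad K L x ∈ _
    rw [hpq.eq_add]
    exact add_mem (LieSubalgebra.subset_lieSpan ⟨_, hx, _, _, hpq, Or.inl rfl⟩)
      (LieSubalgebra.subset_lieSpan ⟨_, hx, _, _, hpq, Or.inr rfl⟩)

/-- The semisimple part `t` combines the semisimple part of the Levi component with the degree 0
radical component; they commute by the choice of `s`. The rest of the radical component lies in
`adNilIdeal`. -/
theorem isDecomposable_of_isSemisimple_ad (hred : IsOfReductiveType ℒ)
    (hss : ∀ A ∈ radical K L, A ∈ ℒ 0 → (ad K L A).IsSemisimple) : IsDecomposable K L := by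
  obtain ⟨s, hs, hcomm⟩ := exists_isGradedLeviFactor_commuting hred hss
  refine isDecomposable_of_exists_isJordanChevalley fun x => ?_
  have hx : x ∈ s.toSubmodule ⊔ (radical K L).toSubmodule := by
    rw [hs.isCompl.sup_eq_top]; exact Submodule.mem_top
  obtain ⟨a, ha, b, hb, rfl⟩ := Submodule.mem_sup.mp hx
  have := isKilling_of_isCompl_radical s hs.isCompl
  obtain ⟨y, hy, z, hz, rfl, hyz, hyss, hznil⟩ := exists_jordan_mem_subalgebra s ha
  have hb0r := component_mem_radical (ℒ := ℒ) 0 hb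
  have hb0 := component_mem ℒ 0 b
  have hyA := hcomm _ hb0r hb0 y hy
  have hsum : y + z + b = (y + component ℒ 0 b) + z + (b - component ℒ 0 b) := by abel
  rw [hsum]
  refine exists_isJordanChevalley_ad ?_ ?_ hznil (sub_component_zero_mem_adNilIdeal hb)
  · rw [add_lie, hyz, hcomm _ hb0r hb0 z hz, add_zero]
  · rw [map_add]
    refine Module.End.IsSemisimple.add_of_commute ?_ hyss (hss _ hb0r hb0)
    have h0 : ⁅ad K L (component ℒ 0 b), ad K L y⁆ = 0 := by rw [← LieHom.map_lie, hyA, map_zero]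
    rw [LieRing.of_associative_ring_bracket, sub_eq_zero] at h0
    exact h0.symm

theorem isDecomposable_iff (hqe : IsQuasiEffective ℒ) (hred : IsOfReductiveType ℒ) :
    IsDecomposable K L ↔ ∀ A : structureSubalgebra ℒ, (A : L) ∈ radical K L →
      (rho ℒ A).IsSemisimple := by
  refine ⟨fun hdec A hA => (isSemisimple_rho_iff hqe A).mpr
    (isSemisimple_ad_of_isDecomposable hred hdec hA A.2), fun h => ?_⟩
  exact isDecomposable_of_isSemisimple_ad hred fun A hA hA0 =>
    (isSemisimple_rho_iff hqe ⟨A, hA0⟩).mp (h ⟨A, hA0⟩ hA)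

end Decomposable

end GradedLie

theorem mainTheorem3 {K L : Type*} [Field K] [CharZero K] [LieRing L] [LieAlgebra K L]
    [FiniteDimensional K L] (ℒ : ℤ → Submodule K L) [GradedLieAlgebra ℒ]
    (hqe : GradedLie.IsQuasiEffective ℒ) (hred : GradedLie.IsOfReductiveType ℒ) :
    -- existence of a graded Levi–Malcev decomposition
    (∃ s : LieSubalgebra K L, GradedLie.IsGradedLeviFactor ℒ s) ∧
    -- all graded Levi factors have one depth `μs`, and degrees between `-μs` and `μs`
    (∃ μs : ℤ, ∀ s : LieSubalgebra K L, GradedLie.IsGradedLeviFactor ℒ s →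
      GradedLie.depth ℒ s.toSubmodule = μs ∧
      s.toSubmodule = ⨆ p ∈ Set.Icc (-μs) μs, s.toSubmodule ⊓ ℒ p) ∧
    -- the radical is graded in degrees between minus its depth and `0`
    (LieAlgebra.radical K L).toSubmodule =
      ⨆ p ∈ Set.Icc (-GradedLie.depth ℒ (LieAlgebra.radical K L).toSubmodule) 0,
        (LieAlgebra.radical K L).toSubmodule ⊓ ℒ p ∧
    (∀ p : ℤ, 0 < p → (LieAlgebra.radical K L).toSubmodule ⊓ ℒ p = ⊥) ∧
    -- the criterion for decomposability
    (GradedLie.IsDecomposable K L ↔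
      ∀ A : GradedLie.structureSubalgebra ℒ, (A : L) ∈ LieAlgebra.radical K L →
        (GradedLie.rho ℒ A).IsSemisimple) ∧
    -- the choice of a graded Levi factor that commutes with `r₀`
    (GradedLie.IsDecomposable K L →
      ∃ s : LieSubalgebra K L, GradedLie.IsGradedLeviFactor ℒ s ∧
        ∀ A ∈ LieAlgebra.radical K L, A ∈ ℒ 0 → ∀ X ∈ s, ⁅A, X⁆ = 0) := by
  obtain ⟨s₀, -, hs₀⟩ := GradedLie.exists_isGradedLeviFactor_le (ℒ := ℒ) ⊤
    (fun _ _ => LieSubalgebra.mem_top _) (by rw [LieSubalgebra.top_toSubmodule, top_sup_eq])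
  refine ⟨⟨s₀, hs₀⟩, ⟨GradedLie.depth ℒ s₀.toSubmodule, fun s hs => ⟨hs.depth_eq hs₀, ?_⟩⟩,
    GradedLie.radical_eq_iSup hqe hred, fun p hp => ?_, GradedLie.isDecomposable_iff hqe hred,
    fun hdec => GradedLie.exists_isGradedLeviFactor_commuting hred fun A hA hA0 =>
      GradedLie.isSemisimple_ad_of_isDecomposable hred hdec hA hA0⟩
  · rw [← hs.depth_eq hs₀]
    exact hs.eq_iSup
  · exact (Submodule.eq_bot_iff _).mpr fun x hx =>
      GradedLie.eq_zero_of_mem_radical_of_pos hqe hred hp hx.1 hx.2
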